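/- A tournament $T=(V(T),\succ)$ is a finite nonempty set $V(T)$ of candidates with an asymmetric and complete binary relation $\succ$ on it. A tournament solution $ts$ maps every tournament $T$ to a nonempty subset $ts(T)\subseteq V(T)$; it is polynomial-time computable if $ts(T)$ can be computed from $T$ in time polynomial in the size of $T$. In an election $(\mathcal C,\mathcal T)$, $\mathcal C$ is a finite nonempty set of candidates and $\mathcal T$ is a list of votes, each of which is a tournament with candidate set $\mathcal C$. Under $ts$-Approval, the score of $c\in\mathcal C$ is the number of votes $T$ in $\mathcal T$ with $c\in ts(T)$, and the candidates with the highest score are the winners. In the unique-winner model, $p$ wins the election if $p$ is its only winner; in the nonunique-winner model, $p$ wins if $p$ is one of its winners. DCAV (destructive control by adding votes) for $ts$-Approval: given a candidate set $\mathcal C$, a list of registered votes and a list of unregistered votes over $\mathcal C$, a distinguished candidate $p\in\mathcal C$ and an integer $k>0$, can one add at most $k$ of the unregistered votes to the registered votes so that $p$ does not win the resulting election? DCDV (destructive control by deleting votes) for $ts$-Approval: given a candidate set $\mathcal C$, a list of votes over $\mathcal C$, a distinguished candidate $p\in\mathcal C$ and an integer $k>0$, can one delete at most $k$ of the votes so that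 $p$ does not win the resulting election? Theorem. For every polynomial-time computable tournament solution $ts$, DCAV and DCDV for $ts$-Approval are solvable in polynomial time, both in the unique-winner model and in the nonunique-winner model. -/

import Mathlib

namespace TSApproval

open Computability Turing

/-! ### Tournaments, tournament solutions and the approval rule -/

/-- A tournament on a finite nonempty set of candidates (candidate names are natural numbers):
an asymmetric and complete binary relation `Beats` on the set `verts`. -/
@[ext]
structure Tournament where
  verts : Finset ℕ
  nonempty : verts.Nonempty
  Beats : ℕ → ℕ → Prop
  mem_of_beats : ∀ a b, Beats a b → a ∈ verts ∧ b ∈ verts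
  asymm : ∀ a b, Beats a b → ¬ Beats b a
  complete : ∀ a ∈ verts, ∀ b ∈ verts, a ≠ b → Beats a b ∨ Beats b a

/-- A tournament solution maps every tournament to a nonempty subset of its candidates. -/
structure TournamentSolution where
  sel : Tournament → Finset ℕ
  subset : ∀ T, sel T ⊆ T.verts
  nonempty : ∀ T, (sel T).Nonempty

/-- The score of the candidate `c`: the number of votes `T` in the list with `c ∈ ts(T)`. -/
def score (ts : TournamentSolution) (votes : List Tournament) (c : ℕ) : ℕ :=
  votes.countP fun T => c ∈ ts.sel T

/-- The winners under `ts`-Approval of the election with candidate set `C` and the given list of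
votes: the candidates with the highest score. -/
def winners (ts : TournamentSolution) (C : Finset ℕ) (votes : List Tournament) : Finset ℕ :=
  C.filter fun c => ∀ d ∈ C, score ts votes d ≤ score ts votes c

/-- The two winner models. -/
inductive WinnerModel
  | unique
  | nonunique

/-- `p` wins the election: as the unique winner in the unique-winner model,
as one of the winners in the nonunique-winner model. -/
def Wins (ts : TournamentSolution) (C : Finset ℕ) (p : ℕ) (votes : List Tournament) :
    WinnerModel → Prop
  | .unique => winners ts C votes = {p}
  | .nonunique => p ∈ winners ts C votes

/-! ### The control problems -/

/-- An instance of control by adding votes. -/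
structure AVInstance where
  candidates : Finset ℕ
  registered : List Tournament
  unregistered : List Tournament
  registered_verts : ∀ T ∈ registered, T.verts = candidates
  unregistered_verts : ∀ T ∈ unregistered, T.verts = candidates
  /-- the distinguished candidate -/
  p : ℕ
  p_mem : p ∈ candidates
  /-- the number of votes that may be added -/
  k : ℕ
  k_pos : 0 < k

/-- An instance of control by deleting votes. -/
structure DVInstance where
  candidates : Finset ℕ
  votes : List Tournament
  votes_verts : ∀ T ∈ votes, T.verts = candidates
  /-- the distinguished candidate -/
  p : ℕ
  p_mem : p ∈ candidates
  /-- the number of votes that may be deleted -/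
  k : ℕ
  k_pos : 0 < k

/-- Destructive control by adding votes for `ts`-Approval: can one add at most `k` of the
unregistered votes to the registered ones so that `p` does not win? -/
def DCAV (ts : TournamentSolution) (model : WinnerModel) (I : AVInstance) : Prop :=
  ∃ added : List Tournament, added.Sublist I.unregistered ∧ added.length ≤ I.k ∧
    ¬ Wins ts I.candidates I.p (I.registered ++ added) model

/-- Destructive control by deleting votes for `ts`-Approval: can one delete at most `k` of the
votes so that `p` does not win? -/
def DCDV (ts : TournamentSolution) (model : WinnerModel) (I : DVInstance) : Prop :=
  ∃ remaining : List Tournament, remaining.Sublist I.votes ∧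
    I.votes.length ≤ remaining.length + I.k ∧
    ¬ Wins ts I.candidates I.p remaining model

/-! ### Encodings, over the alphabet `Γ'` with the bits and the symbols `bra`, `ket`, `comma` -/

/-- A natural number, in binary. -/
def encNat (n : ℕ) : List Γ' := (encodeNat n).map Γ'.bit

/-- A list, between brackets and with every entry followed by a comma. -/
def encList {α : Type} (enc : α → List Γ') (l : List α) : List Γ' :=
  Γ'.bra :: (l.flatMap fun x => enc x ++ [Γ'.comma]) ++ [Γ'.ket]

/-- A finite set of candidates, as the increasing list of its elements. -/
def encCandidates (C : Finset ℕ) : List Γ' := encList encNat (C.sort (· ≤ ·))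

open Classical in
/-- A tournament, as its candidate set followed by its adjacency matrix, row by row. -/
noncomputable def encTournament (T : Tournament) : List Γ' :=
  encCandidates T.verts ++
    (T.verts.sort (· ≤ ·)).flatMap fun a =>
      (T.verts.sort (· ≤ ·)).map fun b => Γ'.bit (decide (T.Beats a b))

noncomputable def encAV (I : AVInstance) : List Γ' :=
  encNat I.p ++ [Γ'.comma] ++ encNat I.k ++ [Γ'.comma] ++ encCandidates I.candidates ++
    encList encTournament I.registered ++ encList encTournament I.unregistered

noncomputable def encDV (I : DVInstance) : List Γ' :=
  encNat I.p ++ [Γ'.comma] ++ encNat I.k ++ [Γ'.comma] ++ encCandidates I.candidates ++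
    encList encTournament I.votes

/-! ### Polynomial time -/

/-- `ts` is polynomial-time computable: some Turing machine computes `ts(T)` from `T` in a number
of steps that is polynomial in the size of `T`. -/
def TournamentSolution.PolyTimeComputable (ts : TournamentSolution) : Prop :=
  Nonempty (TM2ComputableInPolyTime encTournament encCandidates ts.sel)

open Classical in
/-- A decision problem (a set of yes-instances) is polynomial-time solvable: some Turing machine
decides it in a number of steps that is polynomial in the size of the instance. -/
def PolyTimeSolvable {α : Type} (enc : α → List Γ') (Yes : α → Prop) : Prop :=
  Nonempty (TM2ComputableInPolyTime enc encodeBool fun I => decide (Yes I))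

end TSApproval

namespace TSApproval

open Computability Turing

/-! Destructive control splits over the opponents of `p`. The candidate `p` fails to win exactly
when some `d ≠ p` has a higher score (nonunique-winner model) or at least the same score
(unique-winner model); this is `not_wins_iff`. For a fixed `d` only the difference between the two
scores counts, and a single vote shifts it by at most one. An added vote helps `d` only if it
selects `d` and not `p`; a deleted vote helps only if it selects `p` and not `d`. If `z` votes of
the helpful kind are available, the best gain is `min z k`, reached by any `min z k` of them. So `d`
succeeds iff `score p < min z k + score d + b`, with `b = 0` or `b = 1` according to the model
(`countP_append_gain`, `countP_remaining_gain`). Once `ts` has been applied to every vote, it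
remains to count and compare once for each opponent.

The larger part of the proof realizes this algorithm as a multi-stack Turing machine with an
explicit time bound. Programs are built from fragments with exits, closed under sequencing and
loops, and each step bound is composed along with the program. The machine for `ts` is embedded as a
subroutine with stacks of its own (`runs_callSub`). `runs_convert` replaces every vote by its
selected set, `runs_evaluate` decides the inequality for one opponent, and `runs_controlLoop` tries
all opponents.

Two points keep the time polynomial. The bound `k` is given in binary and may be exponential in the
input length, but only `min k n` matters for `n` available votes; this number is produced in unary
by one decrement per vote. And `ts(T) ⊆ V(T)` makes the encoding of a selected set no longer than
that of its vote, so the converted lists fit within the input length. -/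

/-! ### Runs of bounded length -/

/-- `RunsIn f n a b`: iterating the transition function `f` leads from `a` to `b` in at most `n`
steps. -/
inductive RunsIn {α : Type} (f : α → Option α) : ℕ → α → α → Prop
  | refl (n : ℕ) (a : α) : RunsIn f n a a
  | step {n : ℕ} {a b c : α} (h : f a = some b) (hr : RunsIn f n b c) : RunsIn f (n + 1) a c

namespace RunsIn

variable {α β : Type} {f : α → Option α} {g : β → Option β}

theorem mono {n m : ℕ} {a b : α} (h : RunsIn f n a b) (hnm : n ≤ m) : RunsIn f m a b := by
  induction h generalizing m with
  | refl n a => exact .refl m a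
  | step h _ ih =>
    obtain ⟨m, rfl⟩ : ∃ k, m = k + 1 := ⟨m - 1, by omega⟩
    exact .step h (ih (by omega))

theorem trans {n m : ℕ} {a b c : α} (h : RunsIn f n a b) (h' : RunsIn f m b c) :
    RunsIn f (n + m) a c := by
  induction h with
  | refl n a => exact h'.mono (by omega)
  | @step n _ _ _ hs _ ih => exact (RunsIn.step hs (ih h')).mono (by omega)

theorem single {a b : α} (h : f a = some b) : RunsIn f 1 a b := .step h (.refl 0 b)

theorem map {n : ℕ} {a b : α} (φ : α → β) (hφ : ∀ a b, f a = some b → g (φ a) = some (φ b))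
    (h : RunsIn f n a b) : RunsIn g n (φ a) (φ b) := by
  induction h with
  | refl n a => exact .refl n _
  | step hs _ ih => exact .step (hφ _ _ hs) ih

/-- The machine model counts an exact number of iterations of a partial step. This lemma and
`exists_iterate` translate between that count and the upper bounds used below, which can be weakened
and added freely. -/
theorem of_iterate : ∀ (n : ℕ) {a b : α}, (flip bind f)^[n] (some a) = some b → RunsIn f n a b
  | 0, a, b, h => by
    cases h
    exact .refl 0 a
  | n + 1, a, b, h => by
    rw [Function.iterate_succ_apply] at h
    cases hfa : f a with
    | none =>
      -- A halted computation never comes back to a configuration.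
      have key : ∀ k : ℕ, (flip bind f)^[k] (none : Option α) = none := by
        intro k
        induction k with
        | zero => rfl
        | succ k ih => rw [Function.iterate_succ_apply]; exact ih
      have h0 : flip bind f (some a) = none := hfa
      rw [h0, key] at h
      cases h
    | some c =>
      have h0 : flip bind f (some a) = some c := hfa
      rw [h0] at h
      exact .step hfa (of_iterate n h)

theorem exists_iterate {n : ℕ} {a b : α} (h : RunsIn f n a b) :
    ∃ m ≤ n, (flip bind f)^[m] (some a) = some b := by
  induction h with
  | refl n a => exact ⟨0, Nat.zero_le n, rfl⟩
  | @step n a b c hs _ ih =>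
    obtain ⟨m, hm, e⟩ := ih
    refine ⟨m + 1, by omega, ?_⟩
    rw [Function.iterate_succ_apply]
    have h0 : flip bind f (some a) = some b := hs
    rw [h0, e]

end RunsIn

/-! ### Relabelling statements -/

section Relabel

variable {K : Type} [DecidableEq K] {Γ : K → Type} {Λ Λ' σ : Type}

/-- Rename the labels of a statement. -/
def mapLabels (φ : Λ → Λ') : TM2.Stmt Γ Λ σ → TM2.Stmt Γ Λ' σ
  | .push k f q => .push k f (mapLabels φ q)
  | .peek k f q => .peek k f (mapLabels φ q)
  | .pop k f q => .pop k f (mapLabels φ q)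
  | .load a q => .load a (mapLabels φ q)
  | .branch p q₁ q₂ => .branch p (mapLabels φ q₁) (mapLabels φ q₂)
  | .goto l => .goto fun v => φ (l v)
  | .halt => .halt

/-- Rename the label of a configuration. -/
def mapCfg (φ : Λ → Λ') (c : TM2.Cfg Γ Λ σ) : TM2.Cfg Γ Λ' σ := ⟨c.l.map φ, c.var, c.stk⟩

theorem stepAux_mapLabels (φ : Λ → Λ') (q : TM2.Stmt Γ Λ σ) (v : σ) (S : ∀ k, List (Γ k)) :
    TM2.stepAux (mapLabels φ q) v S = mapCfg φ (TM2.stepAux q v S) := by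
  induction q generalizing v S with
  | push k f q ih => exact ih _ _
  | peek k f q ih => exact ih _ _
  | pop k f q ih => exact ih _ _
  | load a q ih => exact ih _ _
  | branch p q₁ q₂ ih₁ ih₂ =>
    simp only [mapLabels, TM2.stepAux]
    cases p v
    · exact ih₂ _ _
    · exact ih₁ _ _
  | goto l => rfl
  | halt => rfl

end Relabel

/-! ### Program fragments -/

/-- A piece of a program for a machine with several stacks: finitely many labels, and exits that
carry a value in `E`. -/
structure Frag {K : Type} (Γ : K → Type) (σ E : Type) where
  Λ : Type
  fin : Fintype Λ
  start : Λ ⊕ E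
  code : Λ → TM2.Stmt Γ (Λ ⊕ E) σ

namespace Frag

variable {K : Type} [DecidableEq K] {Γ : K → Type} {σ E E' A : Type}

/-- One step of a fragment, which stops at its exits. -/
def step (F : Frag Γ σ E) : TM2.Cfg Γ (F.Λ ⊕ E) σ → Option (TM2.Cfg Γ (F.Λ ⊕ E) σ)
  | ⟨some (.inl l), v, S⟩ => some (TM2.stepAux (F.code l) v S)
  | _ => none

/-- Started on the stacks `S` with internal state `v`, the fragment leaves through the exit `e`,
with the stacks `S'` and the same internal state, after at most `n` steps. -/
def Reach (F : Frag Γ σ E) (v : σ) (S : ∀ k, List (Γ k)) (e : E) (S' : ∀ k, List (Γ k)) (n : ℕ) :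
    Prop :=
  RunsIn F.step n ⟨some F.start, v, S⟩ ⟨some (.inr e), v, S'⟩

theorem Reach.mono {F : Frag Γ σ E} {v : σ} {S S' : ∀ k, List (Γ k)} {e : E} {n m : ℕ}
    (h : F.Reach v S e S' n) (hnm : n ≤ m) : F.Reach v S e S' m :=
  RunsIn.mono h hnm

/-- The runs of a fragment are runs of any larger program that contains it. -/
theorem RunsIn.embed {F : Frag Γ σ E} {G : Frag Γ σ E'} (φ : F.Λ ⊕ E → G.Λ ⊕ E')
    (ψ : F.Λ → G.Λ) (hφ : ∀ l, φ (.inl l) = .inl (ψ l))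
    (hcode : ∀ l, G.code (ψ l) = mapLabels φ (F.code l)) {n : ℕ}
    {c c' : TM2.Cfg Γ (F.Λ ⊕ E) σ} (h : RunsIn F.step n c c') :
    RunsIn G.step n (mapCfg φ c) (mapCfg φ c') := by
  refine h.map (mapCfg φ) ?_
  rintro ⟨_ | l | e, v, S⟩ b hb
  · cases hb
  · cases hb
    change G.step ⟨some (φ (.inl l)), v, S⟩ = _
    rw [hφ]
    change some (TM2.stepAux (G.code (ψ l)) v S) = _
    rw [hcode, stepAux_mapLabels]
  · cases hb

/-- The empty program. -/
def ret (e : E) : Frag Γ σ E where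
  Λ := Empty
  fin := inferInstance
  start := .inr e
  code := Empty.elim

theorem reach_ret (v : σ) (S : ∀ k, List (Γ k)) (e : E) : (ret e : Frag Γ σ E).Reach v S e S 0 :=
  .refl 0 _

/-- Run `F`, then the continuation `G e` for the value `e` with which `F` was left. -/
def bind [Fintype E] (F : Frag Γ σ E) (G : E → Frag Γ σ E') : Frag Γ σ E' where
  Λ := F.Λ ⊕ (Σ e, (G e).Λ)
  fin :=
    letI := F.fin
    letI := fun e => (G e).fin
    inferInstance
  start := Sum.elim (fun l => .inl (.inl l))
    (fun e => Sum.map (fun l => .inr ⟨e, l⟩) id (G e).start) F.start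
  code
    | .inl l => mapLabels (Sum.elim (fun l => .inl (.inl l))
        (fun e => Sum.map (fun l => .inr ⟨e, l⟩) id (G e).start)) (F.code l)
    | .inr ⟨e, l⟩ => mapLabels (Sum.map (fun l => .inr ⟨e, l⟩) id) ((G e).code l)

/-- Sequencing costs no step: the exit `e` of `F` is renamed to the start of `G e`, so the last jump
of `F` already lands there. -/
theorem Reach.bind [Fintype E] {F : Frag Γ σ E} {G : E → Frag Γ σ E'} {v : σ}
    {S S' S'' : ∀ k, List (Γ k)} {e : E} {e' : E'} {n m : ℕ} (h : F.Reach v S e S' n)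
    (h' : (G e).Reach v S' e' S'' m) : (F.bind G).Reach v S e' S'' (n + m) := by
  refine RunsIn.trans (b := ⟨some (Sum.map (fun l => .inr ⟨e, l⟩) id (G e).start), v, S'⟩) ?_ ?_
  · exact RunsIn.embed (G := F.bind G) (Sum.elim (fun l => .inl (.inl l))
        (fun e => Sum.map (fun l => .inr ⟨e, l⟩) id (G e).start)) Sum.inl (fun _ => rfl)
        (fun _ => rfl) h
  · exact RunsIn.embed (G := F.bind G) (Sum.map (fun l => .inr ⟨e, l⟩) id)
        (fun l => Sum.inr ⟨e, l⟩) (fun _ => rfl) (fun _ => rfl) h'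

/-- Repeat `F`, started with the value `a`, as long as it is left with a value in `A`. -/
def iter [Fintype A] (F : A → Frag Γ σ (A ⊕ E)) (a : A) : Frag Γ σ E where
  Λ := A ⊕ (Σ a, (F a).Λ)
  fin :=
    letI := fun a => (F a).fin
    inferInstance
  start := .inl (.inl a)
  code
    | .inl a => .goto fun _ => Sum.elim (fun l => .inl (.inr ⟨a, l⟩))
        (Sum.elim (fun a => .inl (.inl a)) .inr) (F a).start
    | .inr ⟨a, l⟩ => mapLabels (Sum.elim (fun l => .inl (.inr ⟨a, l⟩))
        (Sum.elim (fun a => .inl (.inl a)) .inr)) ((F a).code l)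

/-- The additional step is the jump from the loop label `a` to the body `F a`. The label is needed
because a body may be left without taking any step. -/
theorem iter_embed [Fintype A] {F : A → Frag Γ σ (A ⊕ E)} {a : A} (a₀ : A) {v : σ}
    {S S' : ∀ k, List (Γ k)} {e : A ⊕ E} {n : ℕ} (h : (F a).Reach v S e S' n) :
    RunsIn (iter F a₀).step (n + 1) ⟨some (.inl (.inl a)), v, S⟩
      ⟨some (Sum.elim (fun a => .inl (.inl a)) .inr e), v, S'⟩ := by
  refine RunsIn.step (b := ⟨some (Sum.elim (fun l => .inl (.inr ⟨a, l⟩))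
        (Sum.elim (fun a => .inl (.inl a)) .inr) (F a).start), v, S⟩) rfl ?_
  exact RunsIn.embed (G := iter F a₀) (Sum.elim (fun l => .inl (.inr ⟨a, l⟩))
        (Sum.elim (fun a => .inl (.inl a)) .inr)) (fun l => Sum.inr ⟨a, l⟩) (fun _ => rfl)
        (fun _ => rfl) h

theorem Reach.iter_exit [Fintype A] {F : A → Frag Γ σ (A ⊕ E)} {a : A} {v : σ}
    {S S' : ∀ k, List (Γ k)} {e : E} {n : ℕ} (h : (F a).Reach v S (.inr e) S' n) :
    (iter F a).Reach v S e S' (n + 1) :=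
  iter_embed a h

theorem Reach.iter_next [Fintype A] {F : A → Frag Γ σ (A ⊕ E)} {a a' : A} {v : σ}
    {S S' S'' : ∀ k, List (Γ k)} {e : E} {n m : ℕ} (h : (F a).Reach v S (.inl a') S' n)
    (h' : (iter F a').Reach v S' e S'' m) : (iter F a).Reach v S e S'' (n + m + 1) := by
  -- The initial value enters only the start of the loop, so loops with different initial values
  -- share their transitions.
  have hstep : (iter F a').step = (iter F a).step := by
    funext c
    rcases c with ⟨_ | _ | _, _, _⟩ <;> rfl
  have h'' : RunsIn (iter F a).step m ⟨some (.inl (.inl a')), v, S'⟩ ⟨some (.inr e), v, S''⟩ :=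
    hstep ▸ h'
  exact ((iter_embed a h).trans h'').mono (by omega)

end Frag

/-! ### The stacks of the decision machine -/

/-- Names of the working stacks. -/
inductive Nm
  | inp | fav | num | cands | cand | votes₁ | votes₂ | bak | word | tmp | aux | pos | neg | elig
  | quota
  deriving DecidableEq

instance : Fintype Nm where
  elems := {.inp, .fav, .num, .cands, .cand, .votes₁, .votes₂, .bak, .word, .tmp, .aux, .pos, .neg,
    .elig, .quota}
  complete a := by cases a <;> decide

/-- Contents of the working stacks. -/
structure St where
  inp : List Γ' := []
  fav : List Γ' := []
  num : List Γ' := []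
  cands : List Γ' := []
  cand : List Γ' := []
  votes₁ : List Γ' := []
  votes₂ : List Γ' := []
  bak : List Γ' := []
  word : List Γ' := []
  tmp : List Γ' := []
  aux : List Γ' := []
  pos : List Γ' := []
  neg : List Γ' := []
  elig : List Γ' := []
  quota : List Γ' := []

/-- The content of a stack. -/
def St.get (S : St) : Nm → List Γ'
  | .inp => S.inp | .fav => S.fav | .num => S.num | .cands => S.cands | .cand => S.cand
  | .votes₁ => S.votes₁ | .votes₂ => S.votes₂ | .bak => S.bak | .word => S.word | .tmp => S.tmp
  | .aux => S.aux | .pos => S.pos | .neg => S.neg | .elig => S.elig | .quota => S.quota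

/-- Replace the content of a stack. -/
def St.set (S : St) (a : Nm) (l : List Γ') : St :=
  match a with
  | .inp => { S with inp := l } | .fav => { S with fav := l } | .num => { S with num := l }
  | .cands => { S with cands := l } | .cand => { S with cand := l }
  | .votes₁ => { S with votes₁ := l } | .votes₂ => { S with votes₂ := l }
  | .bak => { S with bak := l } | .word => { S with word := l } | .tmp => { S with tmp := l }
  | .aux => { S with aux := l } | .pos => { S with pos := l } | .neg => { S with neg := l }
  | .elig => { S with elig := l } | .quota => { S with quota := l }

theorem St.get_set (S : St) (a b : Nm) (l : List Γ') :
    (S.set a l).get b = if b = a then l else S.get b := by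
  cases a <;> cases b <;> rfl

@[simp] theorem St.get_set_self (S : St) (a : Nm) (l : List Γ') : (S.set a l).get a = l := by
  cases a <;> rfl

theorem St.get_set_ne (S : St) {a b : Nm} (h : b ≠ a) (l : List Γ') :
    (S.set a l).get b = S.get b := by
  rw [St.get_set, if_neg h]

@[simp] theorem St.set_set (S : St) (a : Nm) (l l' : List Γ') :
    (S.set a l).set a l' = S.set a l' := by
  cases a <;> rfl

@[simp] theorem St.set_get (S : St) (a : Nm) : S.set a (S.get a) = S := by
  cases a <;> rfl

section Machine

variable (M : FinTM2)

/-- Stacks: those of the subroutine `M`, the working stacks, and one for the answer. -/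
abbrev Stk : Type := M.K ⊕ (Nm ⊕ Unit)

/-- The alphabets of the stacks. -/
abbrev Alph : Stk M → Type
  | .inl k => M.Γ k
  | .inr (.inl _) => Γ'
  | .inr (.inr _) => Bool

/-- The internal states: one for the subroutine and the symbol read last. -/
abbrev Reg : Type := M.σ × Option Γ'

/-- The rest position of the internal state. -/
abbrev reg₀ : Reg M := (M.initialState, none)

variable {M} in
/-- The contents of all stacks. -/
def full (R : ∀ k, List (M.Γ k)) (S : St) (o : List Bool) : ∀ k, List (Alph M k)
  | .inl k => R k
  | .inr (.inl a) => S.get a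
  | .inr (.inr _) => o

variable {M}

theorem update_full_inl (R : ∀ k, List (M.Γ k)) (S : St) (o : List Bool) (k : M.K)
    (l : List (M.Γ k)) :
    Function.update (full R S o) (.inl k) l = full (Function.update R k l) S o := by
  funext j
  rcases j with j | j | j
  · by_cases h : j = k
    · subst h
      simp [full]
    · rw [Function.update_of_ne (by simpa using h)]
      simp [full, Function.update_of_ne h]
  · rw [Function.update_of_ne (by simp)]; rfl
  · rw [Function.update_of_ne (by simp)]; rfl

theorem update_full_inr (R : ∀ k, List (M.Γ k)) (S : St) (o : List Bool) (a : Nm)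
    (l : List Γ') :
    Function.update (full R S o) (.inr (.inl a)) l = full R (S.set a l) o := by
  funext j
  rcases j with j | j | j
  · rw [Function.update_of_ne (by simp)]; rfl
  · by_cases h : j = a
    · subst h
      simp [full]
    · rw [Function.update_of_ne (by simpa using h)]
      exact (S.get_set_ne h l).symm
  · rw [Function.update_of_ne (by simp)]; rfl

theorem update_full_out (R : ∀ k, List (M.Γ k)) (S : St) (o : List Bool) (l : List Bool) :
    Function.update (full R S o) (.inr (.inr ())) l = full R S l := by
  funext j
  rcases j with j | j | j
  · rw [Function.update_of_ne (by simp)]; rfl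
  · rw [Function.update_of_ne (by simp)]; rfl
  · simp [full]

variable (M) in
/-- Programs for the decision machine. -/
abbrev Prog (E : Type) : Type 1 := Frag (Alph M) (Reg M) E

/-- Started on the working stacks `S`, all other stacks being empty, the program leaves through
the exit `e` with the working stacks `S'` after at most `n` steps. -/
def Runs {E : Type} (F : Prog M E) (S : St) (e : E) (S' : St) (n : ℕ) : Prop :=
  F.Reach (reg₀ M) (full (fun _ => []) S []) e (full (fun _ => []) S' []) n

/-! ### Elementary programs -/

/-- Push a symbol. -/
def pushOn (k : Stk M) (s : Alph M k) : Prog M Unit where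
  Λ := Unit
  fin := inferInstance
  start := .inl ()
  code _ := .push k (fun _ => s) (.goto fun _ => .inr ())

theorem reach_pushOn (k : Stk M) (s : Alph M k) (S : ∀ k, List (Alph M k)) :
    (pushOn k s).Reach (reg₀ M) S () (Function.update S k (s :: S k)) 1 :=
  .single rfl

/-- Pop a symbol, translate it by `f`, and leave through the corresponding exit. -/
def popFrom (k : Stk M) (f : Alph M k → Γ') : Prog M (Option Γ') where
  Λ := Unit ⊕ Option Γ'
  fin := inferInstance
  start := .inl (.inl ())
  code
    | .inl _ => .pop k (fun v s => (v.1, s.map f)) (.goto fun v => .inl (.inr v.2))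
    | .inr s => .load (fun v => (v.1, none)) (.goto fun _ => .inr s)

theorem reach_popFrom (k : Stk M) (f : Alph M k → Γ') (S : ∀ k, List (Alph M k)) :
    (popFrom k f).Reach (reg₀ M) S ((S k).head?.map f) (Function.update S k (S k).tail) 2 :=
  .step rfl (.single rfl)

/-- Push a symbol on a working stack. -/
def push (a : Nm) (s : Γ') : Prog M Unit := pushOn (.inr (.inl a)) s

/-- Pop a symbol from a working stack. -/
def pop (a : Nm) : Prog M (Option Γ') := popFrom (.inr (.inl a)) id

theorem runs_push (a : Nm) (s : Γ') (S : St) :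
    Runs (M := M) (push a s) S () (S.set a (s :: S.get a)) 1 := by
  have h := reach_pushOn (M := M) (.inr (.inl a)) s (full (fun _ => []) S [])
  rwa [update_full_inr] at h

theorem runs_pop (a : Nm) (S : St) :
    Runs (M := M) (pop a) S (S.get a).head? (S.set a (S.get a).tail) 2 := by
  have h := reach_popFrom (M := M) (.inr (.inl a)) id (full (fun _ => []) S [])
  rw [update_full_inr, Option.map_id] at h
  exact h

theorem runs_pop_cons {a : Nm} {S : St} {s : Γ'} {l : List Γ'} (h : S.get a = s :: l) :
    Runs (M := M) (pop a) S (some s) (S.set a l) 2 := by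
  have := runs_pop (M := M) a S
  rwa [h] at this

theorem runs_pop_nil {a : Nm} {S : St} (h : S.get a = []) :
    Runs (M := M) (pop a) S none S 2 := by
  have := runs_pop (M := M) a S
  rw [h] at this
  have e : S.set a [].tail = S := by
    conv_rhs => rw [← S.set_get a, h]
    rfl
  rwa [e] at this

theorem runs_ret {E : Type} (e : E) (S : St) : Runs (M := M) (.ret e) S e S 0 :=
  Frag.reach_ret _ _ e

/-! ### Rules for composing runs -/

section Rules

variable {E E' A : Type} {S S' S'' : St} {n m : ℕ}

theorem Runs.mono {F : Prog M E} {e : E} (h : Runs F S e S' n) (hnm : n ≤ m) :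
    Runs F S e S' m :=
  Frag.Reach.mono h hnm

theorem Runs.bind [Fintype E] {F : Prog M E} {G : E → Prog M E'} {e : E} {e' : E'}
    (h : Runs F S e S' n) (h' : Runs (G e) S' e' S'' m) : Runs (F.bind G) S e' S'' (n + m) :=
  Frag.Reach.bind h h'

theorem Runs.iter_exit [Fintype A] {F : A → Prog M (A ⊕ E)} {a : A} {e : E}
    (h : Runs (F a) S (.inr e) S' n) : Runs (.iter F a) S e S' (n + 1) :=
  Frag.Reach.iter_exit h

theorem Runs.iter_next [Fintype A] {F : A → Prog M (A ⊕ E)} {a a' : A} {e : E}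
    (h : Runs (F a) S (.inl a') S' n) (h' : Runs (.iter F a') S' e S'' m) :
    Runs (.iter F a) S e S'' (n + m + 1) :=
  Frag.Reach.iter_next h h'

end Rules

/-! ### The subroutine call -/

/-- The statements of the subroutine, as statements of the large machine. -/
def liftStmt : TM2.Stmt M.Γ M.Λ M.σ → TM2.Stmt (Alph M) (M.Λ ⊕ Unit) (Reg M)
  | .push k f q => .push (.inl k) (fun v => f v.1) (liftStmt q)
  | .peek k f q => .peek (.inl k) (fun v s => (f v.1 s, v.2)) (liftStmt q)
  | .pop k f q => .pop (.inl k) (fun v s => (f v.1 s, v.2)) (liftStmt q)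
  | .load a q => .load (fun v => (a v.1, v.2)) (liftStmt q)
  | .branch p q₁ q₂ => .branch (fun v => p v.1) (liftStmt q₁) (liftStmt q₂)
  | .goto l => .goto fun v => .inl (l v.1)
  | .halt => .goto fun _ => .inr ()

/-- The configurations of the subroutine, as configurations of the large machine. -/
def liftCfg (S : St) (c : TM2.Cfg M.Γ M.Λ M.σ) : TM2.Cfg (Alph M) (M.Λ ⊕ Unit) (Reg M) :=
  ⟨some (c.l.elim (.inr ()) .inl), (c.var, none), full c.stk S []⟩

/-- Lifted statements touch only the stacks of `M` and the first component of the internal state.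
Halting turns into a jump to the exit, which is why `liftCfg` sends the missing label of a halted
configuration there. -/
theorem stepAux_liftStmt (S : St) (q : TM2.Stmt M.Γ M.Λ M.σ) (v : M.σ)
    (R : ∀ k, List (M.Γ k)) :
    TM2.stepAux (liftStmt q) (v, none) (full R S []) = liftCfg S (TM2.stepAux q v R) := by
  induction q generalizing v R with
  | push k f q ih =>
    simp only [liftStmt, TM2.stepAux]
    rw [update_full_inl]
    exact ih _ _
  | peek k f q ih => exact ih _ _
  | pop k f q ih =>
    simp only [liftStmt, TM2.stepAux]
    rw [update_full_inl]
    exact ih _ _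
  | load a q ih => exact ih _ _
  | branch p q₁ q₂ ih₁ ih₂ =>
    simp only [liftStmt, TM2.stepAux]
    cases p v
    · exact ih₂ _ _
    · exact ih₁ _ _
  | goto l => rfl
  | halt => rfl

variable (M) in
/-- Run the subroutine. -/
def runSub : Prog M Unit where
  Λ := M.Λ
  fin := M.ΛFin
  start := .inl M.main
  code l := liftStmt (M.m l)

theorem runSub_step {n : ℕ} (S : St) {c c' : M.Cfg} (h : RunsIn M.step n c c') :
    RunsIn (runSub M).step n (liftCfg S c) (liftCfg S c') := by
  refine h.map (liftCfg S) ?_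
  rintro ⟨_ | l, v, R⟩ b hb
  · cases hb
  · cases hb
    exact congrArg some (stepAux_liftStmt S (M.m l) v R)

theorem initList_stk (s : List (M.Γ M.k₀)) :
    initList M s = ⟨some M.main, M.initialState, Function.update (fun _ => []) M.k₀ s⟩ := by
  unfold initList
  congr 1
  funext k
  by_cases h : k = M.k₀
  · subst h
    simp
  · simp [h]

theorem haltList_stk (s : List (M.Γ M.k₁)) :
    haltList M s = ⟨none, M.initialState, Function.update (fun _ => []) M.k₁ s⟩ := by
  unfold haltList
  congr 1
  funext k
  by_cases h : k = M.k₁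
  · subst h
    simp
  · simp [h]

/-- A halting configuration carries the initial internal state, and all its stacks except the output
stack are empty. Once the output is fetched, the call leaves no trace and can be repeated for the
next vote. -/
theorem reach_runSub {s : List (M.Γ M.k₀)} {s' : List (M.Γ M.k₁)} {n : ℕ}
    (h : TM2OutputsInTime M s (some s') n) (S : St) :
    (runSub M).Reach (reg₀ M) (full (Function.update (fun _ => []) M.k₀ s) S []) ()
      (full (Function.update (fun _ => []) M.k₁ s') S []) n := by
  have h1 : RunsIn M.step n (initList M s) (haltList M s') :=
    (RunsIn.of_iterate _ h.evals_in_steps).mono h.steps_le_m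
  have h2 := runSub_step S h1
  rw [initList_stk, haltList_stk] at h2
  exact h2

/-- Move the stack `tmp` to the input stack of the subroutine. -/
def feed (α : M.Γ M.k₀ ≃ Γ') : Prog M Unit :=
  .iter (A := Unit) (fun _ => (pop .tmp).bind fun
    | none => .ret (.inr ())
    | some s => (pushOn (.inl M.k₀) (α.symm s)).bind fun _ => .ret (.inl ())) ()

/-- Every symbol costs four steps: two for the pop, one for the push, one for the loop. The failing
pop at the end costs three. The content `r` is arbitrary for the sake of the induction. -/
theorem reach_feed (α : M.Γ M.k₀ ≃ Γ') (l : List Γ') (S : St) (r : List (M.Γ M.k₀))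
    (R : ∀ k, List (M.Γ k)) (h : S.tmp = l) :
    (feed α).Reach (reg₀ M) (full (Function.update R M.k₀ r) S []) ()
      (full (Function.update R M.k₀ ((l.map α.symm).reverse ++ r)) { S with tmp := [] } [])
      (4 * l.length + 3) := by
  induction l generalizing S r with
  | nil =>
    have hp := reach_popFrom (M := M) (.inr (.inl .tmp)) id (full (Function.update R M.k₀ r) S [])
    rw [update_full_inr] at hp
    have hg : S.get .tmp = [] := h
    simp only [full, hg] at hp
    refine Frag.Reach.iter_exit (hp.bind (m := 0) ?_)
    exact Frag.reach_ret _ _ _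
  | cons s l ih =>
    have hp := reach_popFrom (M := M) (.inr (.inl .tmp)) id (full (Function.update R M.k₀ r) S [])
    rw [update_full_inr] at hp
    have hg : S.get .tmp = s :: l := h
    simp only [full, hg] at hp
    have hq := reach_pushOn (M := M) (.inl M.k₀) (α.symm s)
      (full (Function.update R M.k₀ r) (S.set .tmp l) [])
    rw [update_full_inl] at hq
    simp only [full, Function.update_idem, Function.update_self] at hq
    simp only [List.map_cons, List.reverse_cons, List.append_assoc, List.singleton_append]
    refine Frag.Reach.mono (Frag.Reach.iter_next (a' := ()) (n := 3) (hp.bind (m := 1) ?_)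
      (ih (S.set .tmp l) (α.symm s :: r) rfl)) ?_
    · refine hq.bind (m := 0) ?_
      exact Frag.reach_ret _ _ _
    simp only [List.length_cons]
    omega

/-- Move the output stack of the subroutine to the stack `aux`. -/
def fetch (β : M.Γ M.k₁ ≃ Γ') : Prog M Unit :=
  .iter (A := Unit) (fun _ => (popFrom (.inl M.k₁) β).bind fun
    | none => .ret (.inr ())
    | some s => (push .aux s).bind fun _ => .ret (.inl ())) ()

theorem reach_fetch (β : M.Γ M.k₁ ≃ Γ') (l : List Γ') (S : St) (R : ∀ k, List (M.Γ k)) :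
    (fetch β).Reach (reg₀ M) (full (Function.update R M.k₁ (l.map β.symm)) S []) ()
      (full (Function.update R M.k₁ []) { S with aux := l.reverse ++ S.aux } [])
      (4 * l.length + 3) := by
  induction l generalizing S with
  | nil =>
    have hp := reach_popFrom (M := M) (.inl M.k₁) β (full (Function.update R M.k₁ []) S [])
    rw [update_full_inl] at hp
    simp only [full, Function.update_idem, Function.update_self] at hp
    refine Frag.Reach.iter_exit (hp.bind (m := 0) ?_)
    exact Frag.reach_ret _ _ _
  | cons s l ih =>
    have hp := reach_popFrom (M := M) (.inl M.k₁) β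
      (full (Function.update R M.k₁ ((s :: l).map β.symm)) S [])
    rw [update_full_inl] at hp
    simp only [full, Function.update_idem, Function.update_self] at hp
    simp only [List.map_cons, List.head?_cons, Option.map_some, Equiv.apply_symm_apply,
      List.tail_cons] at hp
    have hq := reach_pushOn (M := M) (.inr (.inl .aux)) s
      (full (Function.update R M.k₁ (l.map β.symm)) S [])
    rw [update_full_inr] at hq
    simp only [List.reverse_cons, List.append_assoc, List.singleton_append]
    refine Frag.Reach.mono (Frag.Reach.iter_next (a' := ()) (n := 3) (hp.bind (m := 1) ?_)
      (ih (S.set .aux (s :: S.aux)))) ?_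
    · refine hq.bind (m := 0) ?_
      exact Frag.reach_ret _ _ _
    simp only [List.length_cons]
    omega

/-- Apply the subroutine to the reversal of the stack `tmp`, and put the reversed result on
`aux`. -/
def callSub (α : M.Γ M.k₀ ≃ Γ') (β : M.Γ M.k₁ ≃ Γ') : Prog M Unit :=
  (feed α).bind fun _ => (runSub M).bind fun _ => fetch β

/-- Moving a stack reverses it. The argument therefore waits on `tmp` in reverse, as it was read
off, and the result arrives on `aux` in reverse, to be straightened by the next move. -/
theorem runs_callSub {α : M.Γ M.k₀ ≃ Γ'} {β : M.Γ M.k₁ ≃ Γ'} {l l' : List Γ'} {n : ℕ}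
    (h : TM2OutputsInTime M (l.map α.symm) (some (l'.map β.symm)) n) {S : St}
    (ht : S.tmp = l.reverse) :
    Runs (callSub α β) S () { S with tmp := [], aux := l'.reverse ++ S.aux }
      (4 * l.length + n + 4 * l'.length + 6) := by
  have h1 := reach_feed α l.reverse S [] (fun _ => []) ht
  have h2 := reach_runSub h { S with tmp := [] }
  have h3 := reach_fetch β l' { S with tmp := [] } (fun _ => [])
  have e : ∀ k, Function.update (fun _ => []) k [] = fun k => ([] : List (M.Γ k)) := fun k =>
    Function.update_eq_self k (fun k => ([] : List (M.Γ k)))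
  rw [e] at h1 h3
  rw [← List.map_reverse, List.reverse_reverse, List.append_nil] at h1
  refine Frag.Reach.mono (h1.bind (h2.bind h3)) ?_
  rw [List.length_reverse]
  omega

/-! ### The complete machine -/

/-- The machine that runs a program and then answers with the value of its exit. -/
def machine (F : Prog M Bool) : FinTM2 where
  K := Stk M
  kFin :=
    letI := M.kFin
    inferInstance
  k₀ := .inr (.inl .inp)
  k₁ := .inr (.inr ())
  Γ := Alph M
  Λ := F.Λ ⊕ Bool
  main := F.start
  ΛFin :=
    letI := F.fin
    inferInstance
  σ := Reg M
  initialState := reg₀ M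
  σFin :=
    letI := M.σFin
    inferInstance
  Γk₀Fin := inferInstanceAs (Fintype Γ')
  m
    | .inl l => F.code l
    | .inr e => .push (.inr (.inr ())) (fun _ => e) .halt

/-- The prescribed halting configuration has every stack empty but the output. Hence the requirement
that `F` end on the empty working stacks, and the clearing at the end of the decision programs. -/
theorem machine_outputs {F : Prog M Bool} {s : List Γ'} {e : Bool} {n : ℕ}
    (h : Runs F { inp := s } e {} n) :
    Nonempty (TM2OutputsInTime (machine F) s (some [e]) (n + 1)) := by
  have h1 : RunsIn (machine F).step n ⟨some F.start, reg₀ M, full (fun _ => []) { inp := s } []⟩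
      ⟨some (.inr e), reg₀ M, full (fun _ => []) {} []⟩ := by
    refine RunsIn.map id ?_ h
    rintro ⟨_ | l | e, v, S⟩ b hb
    · cases hb
    · exact hb
    · cases hb
  have h2 : RunsIn (machine F).step 1
      ⟨some (.inr e), reg₀ M, full (fun _ => []) {} []⟩
      ⟨none, reg₀ M, full (fun _ => []) {} [e]⟩ := by
    refine .single (congrArg some ?_)
    rw [← update_full_out _ _ [] [e]]
    rfl
  obtain ⟨m, hm, hit⟩ := (h1.trans h2).exists_iterate
  refine ⟨⟨⟨m, ?_⟩, hm⟩⟩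
  have e1 : initList (machine F) s
      = ⟨some F.start, reg₀ M, full (fun _ => []) { inp := s } []⟩ := by
    refine (initList_stk (M := machine F) s).trans ?_
    congr 1
    funext k
    rcases k with k | k | k
    · rfl
    · cases k <;> rfl
    · rfl
  have e2 : haltList (machine F) [e] = ⟨none, reg₀ M, full (fun _ => []) {} [e]⟩ := by
    refine (haltList_stk (M := machine F) [e]).trans ?_
    congr 1
    funext k
    rcases k with k | k | k
    · rfl
    · cases k <;> rfl
    · rfl
  rw [e1]
  change _ = some (haltList (machine F) [e])
  rw [e2]
  exact hit

theorem polyTimeSolvable_of_runs {α : Type} {enc : α → List Γ'} {Yes : α → Prop}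
    (F : Prog M Bool) (time : Polynomial ℕ)
    (h : ∀ a, ∃ e, (e = true ↔ Yes a) ∧
      Runs F { inp := enc a } e {} (time.eval (enc a).length)) :
    PolyTimeSolvable enc Yes := by
  classical
  refine ⟨{ tm := machine F
            inputAlphabet := Equiv.refl Γ'
            outputAlphabet := Equiv.refl Bool
            -- The extra unit pays for pushing the answer.
            time := time + 1
            outputsFun := fun a => ?_ }⟩
  refine Classical.choice ?_
  obtain ⟨e, he, hr⟩ := h a
  have hd : decide (Yes a) = e := by
    cases e <;> simp_all
  have := machine_outputs hr
  rw [hd, Polynomial.eval_add, Polynomial.eval_one]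
  exact (List.map_id (enc a)).symm ▸ this

end Machine

/-! ### Routines for moving, clearing, reading and comparing stacks -/

theorem St.ext_get {S S' : St} (h : ∀ a, S.get a = S'.get a) : S = S' := by
  cases S
  cases S'
  simp only [St.mk.injEq]
  exact ⟨h .inp, h .fav, h .num, h .cands, h .cand, h .votes₁, h .votes₂, h .bak, h .word, h .tmp,
    h .aux, h .pos, h .neg, h .elig, h .quota⟩

section Routines

variable {M : FinTM2}

theorem Runs.of_eq {E : Type} {F : Prog M E} {S S' S'' : St} {e : E} {n m : ℕ}
    (h : Runs F S e S' n) (hS : S' = S'') (hnm : n ≤ m) : Runs F S e S'' m :=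
  hS ▸ h.mono hnm

/-- Move the stack `a` onto the stack `b`, reversing it. -/
def moveTo (a b : Nm) : Prog M Unit :=
  .iter (A := Unit) (fun _ => (pop a).bind fun
    | none => .ret (.inr ())
    | some s => (push b s).bind fun _ => .ret (.inl ())) ()

theorem runs_moveTo {a b : Nm} (hab : a ≠ b) {l : List Γ'} {S : St} (h : S.get a = l) :
    Runs (M := M) (moveTo a b) S () ((S.set a []).set b (l.reverse ++ S.get b))
      (4 * l.length + 3) := by
  induction l generalizing S with
  | nil =>
    refine Runs.of_eq (n := 3) (Runs.iter_exit (n := 2)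
      ((runs_pop_nil h).bind (m := 0) (runs_ret _ _))) ?_ (by simp)
    refine St.ext_get fun c => ?_
    simp only [St.get_set]
    grind
  | cons s l ih =>
    refine Runs.of_eq (Runs.iter_next (a' := ()) (n := 3)
      ((runs_pop_cons h).bind (m := 1) ((runs_push b s _).bind (m := 0) (runs_ret _ _)))
      (ih (by simp [St.get_set, hab]))) ?_ (by simp; omega)
    refine St.ext_get fun c => ?_
    simp only [St.get_set]
    grind

/-- Empty the stack `a`. -/
def clear (a : Nm) : Prog M Unit :=
  .iter (A := Unit) (fun _ => (pop a).bind fun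
    | none => .ret (.inr ())
    | some _ => .ret (.inl ())) ()

theorem runs_clear {a : Nm} {l : List Γ'} {S : St} (h : S.get a = l) :
    Runs (M := M) (clear a) S () (S.set a []) (3 * l.length + 3) := by
  induction l generalizing S with
  | nil =>
    refine Runs.of_eq (n := 3) (Runs.iter_exit (n := 2)
      ((runs_pop_nil h).bind (m := 0) (runs_ret _ _))) ?_ (by simp)
    rw [← h, St.set_get]
  | cons s l ih =>
    refine Runs.of_eq (Runs.iter_next (a' := ()) (n := 2)
      ((runs_pop_cons h).bind (m := 0) (runs_ret _ _)) (ih (by simp))) (by simp)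
      (by simp; omega)

/-- Empty several stacks. -/
def clearAll : List Nm → Prog M Unit
  | [] => .ret ()
  | a :: l => (clear a).bind fun _ => clearAll l

theorem runs_clearAll (N : ℕ) (l : List Nm) (S : St) (h : ∀ a ∈ l, (S.get a).length ≤ N) :
    Runs (M := M) (clearAll l) S () (l.foldl (fun S a => S.set a []) S)
      (l.length * (3 * N + 3)) := by
  induction l generalizing S with
  | nil => exact (runs_ret _ _).mono (by simp)
  | cons a l ih =>
    have h1 := h a (by simp)
    refine Runs.mono ((runs_clear rfl).bind (ih (S.set a []) fun b hb => ?_)) ?_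
    · rw [St.get_set]
      split_ifs
      · simp
      · exact h b (by simp [hb])
    · simp only [List.length_cons]
      nlinarith

/-- Move bits from the stack `a` to the stack `b`, up to the first symbol that is not a bit; remove
that symbol from `a` and return it. -/
def readBits (a b : Nm) : Prog M (Option Γ') :=
  .iter (A := Unit) (fun _ => (pop a).bind fun
    | some (.bit s) => (push b (.bit s)).bind fun _ => .ret (.inl ())
    | s => .ret (.inr s)) ()

/-- The case of empty `r` is included: the value `none` then reports the end of the stack, which is
how the loop over the opponents stops. -/
theorem runs_readBits {a b : Nm} (hab : a ≠ b) {w : List Bool} {r : List Γ'} {S : St}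
    (h : S.get a = w.map Γ'.bit ++ r) (hr : ∀ s, r.head? ≠ some (Γ'.bit s)) :
    Runs (M := M) (readBits a b) S r.head?
      ((S.set a r.tail).set b ((w.map Γ'.bit).reverse ++ S.get b)) (4 * w.length + 3) := by
  induction w generalizing S with
  | nil =>
    have hp := runs_pop (M := M) a S
    rw [h] at hp
    refine Runs.of_eq (S' := S.set a r.tail) (n := 3)
      (Runs.iter_exit (n := 2) (hp.bind (m := 0) ?_)) ?_ (by simp)
    · simp only [List.map_nil, List.nil_append]
      rcases hh : r.head? with _ | s
      · exact runs_ret _ _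
      · cases s with
        | bit s => exact absurd hh (hr s)
        | _ => exact runs_ret _ _
    · refine St.ext_get fun c => ?_
      simp only [St.get_set]
      grind
  | cons s l ih =>
    refine Runs.of_eq (Runs.iter_next (a' := ()) (n := 3)
      ((runs_pop_cons h).bind (m := 1) ((runs_push b _ _).bind (m := 0) (runs_ret _ _)))
      (ih (by simp [St.get_set, hab]))) ?_ (by simp; omega)
    refine St.ext_get fun c => ?_
    simp only [St.get_set]
    grind

/-- Move symbols from the stack `a` to the stack `b`, up to and including the first `ket`. -/
def readKet (a b : Nm) : Prog M Unit :=
  .iter (A := Unit) (fun _ => (pop a).bind fun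
    | none => .ret (.inr ())
    | some .ket => (push b .ket).bind fun _ => .ret (.inr ())
    | some s => (push b s).bind fun _ => .ret (.inl ())) ()

theorem runs_readKet {a b : Nm} (hab : a ≠ b) {l r : List Γ'} {S : St}
    (h : S.get a = l ++ Γ'.ket :: r) (hl : Γ'.ket ∉ l) :
    Runs (M := M) (readKet a b) S () ((S.set a r).set b (Γ'.ket :: (l.reverse ++ S.get b)))
      (4 * l.length + 4) := by
  induction l generalizing S with
  | nil =>
    refine Runs.of_eq (n := 4) (Runs.iter_exit (n := 3)
      ((runs_pop_cons h).bind (m := 1) ((runs_push b _ _).bind (m := 0) (runs_ret _ _)))) ?_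
      (by simp)
    refine St.ext_get fun c => ?_
    simp only [St.get_set]
    grind
  | cons s l ih =>
    refine Runs.of_eq (Runs.iter_next (a' := ()) (n := 3)
      ((runs_pop_cons h).bind (m := 1) ?_)
      (ih (S := (S.set a (l ++ Γ'.ket :: r)).set b (s :: (S.set a (l ++ Γ'.ket :: r)).get b))
        (by simp [St.get_set, hab]) (by simp_all))) ?_ (by simp; omega)
    · cases s with
      | ket => simp at hl
      | _ => exact (runs_push b _ _).bind (m := 0) (runs_ret _ _)
    · refine St.ext_get fun c => ?_
      simp only [St.get_set]
      grind

/-- Compare the stacks `a` and `b`, moving them to `tmp` and `aux`. -/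
def eqLoop (a b : Nm) (v : Bool) : Prog M Bool :=
  .iter (A := Bool) (fun v => (pop a).bind fun s => (pop b).bind fun s' =>
    match s, s' with
    | none, none => .ret (.inr v)
    | some s, none => (push .tmp s).bind fun _ => .ret (.inl false)
    | none, some s' => (push .aux s').bind fun _ => .ret (.inl false)
    | some s, some s' => (push .tmp s).bind fun _ => (push .aux s').bind fun _ =>
        .ret (.inl (v && decide (s = s')))) v

/-- Test whether the stacks `a` and `b` are equal. -/
def eqTest (a b : Nm) : Prog M Bool :=
  (eqLoop a b true).bind fun v => (moveTo .tmp a).bind fun _ => (moveTo .aux b).bind fun _ =>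
    .ret v

/-- After one stack is exhausted the loop goes on draining the other, so that both can be restored.
The induction therefore runs on a bound for the total length, which drops in every round. -/
theorem runs_eqLoop {a b : Nm} (hab : a ≠ b) (ha : a ≠ .tmp ∧ a ≠ .aux) (hb : b ≠ .tmp ∧ b ≠ .aux)
    (v : Bool) (n : ℕ) {l l' : List Γ'} {S : St} (h : S.get a = l) (h' : S.get b = l')
    (hn : l.length + l'.length ≤ n) :
    Runs (M := M) (eqLoop a b v) S (v && decide (l = l'))
      ((((S.set a []).set b []).set .tmp (l.reverse ++ S.get .tmp)).set .aux
        (l'.reverse ++ S.get .aux)) (7 * n + 5) := by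
  obtain ⟨ha1, ha2⟩ := ha
  obtain ⟨hb1, hb2⟩ := hb
  induction n generalizing S l l' v with
  | zero =>
    obtain rfl : l = [] := List.length_eq_zero_iff.1 (by omega)
    obtain rfl : l' = [] := List.length_eq_zero_iff.1 (by omega)
    simp only [decide_true, Bool.and_true]
    refine Runs.of_eq (n := 5) (Runs.iter_exit (n := 4)
      ((runs_pop_nil h).bind (m := 2) ((runs_pop_nil h').bind (m := 0) (runs_ret _ _)))) ?_
      (by simp)
    refine St.ext_get fun c => ?_
    simp only [St.get_set]
    grind
  | succ n ih =>
    rcases l with _ | ⟨s, l⟩ <;> rcases l' with _ | ⟨s', l'⟩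
    · refine (ih v h h' (by simp)).mono (by omega)
    -- A surplus symbol sets the flag to `false` for good, whatever the remaining stacks are.
    · rw [show (v && decide ([] = s' :: l')) = (false && decide ([] = l')) by simp]
      refine Runs.of_eq (Runs.iter_next (a' := false) (n := 5)
        ((runs_pop_nil h).bind (m := 3) ((runs_pop_cons h').bind (m := 1)
          ((runs_push .aux _ _).bind (m := 0) (runs_ret _ _))))
        (ih false (l := []) (l' := l') ?_ ?_ (by simp at hn ⊢; omega))) ?_ (by omega)
      · simp [St.get_set, *]
      · simp [St.get_set, *]
      · refine St.ext_get fun c => ?_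
        simp only [St.get_set]
        grind
    · rw [show (v && decide (s :: l = [])) = (false && decide (l = [])) by simp]
      refine Runs.of_eq (Runs.iter_next (a' := false) (n := 5)
        ((runs_pop_cons h).bind (m := 3) ((runs_pop_nil (by simp [St.get_set, hab.symm, h'])).bind
          (m := 1) ((runs_push .tmp _ _).bind (m := 0) (runs_ret _ _))))
        (ih false (l := l) (l' := []) ?_ ?_ (by simp at hn ⊢; omega))) ?_ (by omega)
      · simp [St.get_set, *]
      · simp [St.get_set, hab.symm, *]
      · refine St.ext_get fun c => ?_
        simp only [St.get_set]
        grind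
    · have e : (v && decide (s :: l = s' :: l')) = (v && decide (s = s') && decide (l = l')) := by
        simp [Bool.and_assoc]
      rw [e]
      refine Runs.of_eq (Runs.iter_next (a' := v && decide (s = s')) (n := 6)
        ((runs_pop_cons h).bind (m := 4)
          ((runs_pop_cons (l := l') (by simp [St.get_set, hab.symm, h'])).bind
          (m := 2) ((runs_push .tmp _ _).bind (m := 1)
            ((runs_push .aux _ _).bind (m := 0) (runs_ret _ _)))))
        (ih (v && decide (s = s')) (l := l) (l' := l') ?_ ?_ (by simp at hn; omega)))
        ?_ (by omega)
      · simp [St.get_set, *]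
      · simp [St.get_set, *]
      · refine St.ext_get fun c => ?_
        simp only [St.get_set]
        grind

theorem runs_eqTest {a b : Nm} (hab : a ≠ b) (ha : a ≠ .tmp ∧ a ≠ .aux)
    (hb : b ≠ .tmp ∧ b ≠ .aux) {S : St} (ht : S.tmp = []) (hu : S.aux = []) :
    Runs (M := M) (eqTest a b) S (decide (S.get a = S.get b)) S
      (11 * ((S.get a).length + (S.get b).length) + 11) := by
  have h1 := runs_eqLoop (M := M) hab ha hb true _ (S := S) rfl rfl le_rfl
  obtain ⟨ha1, ha2⟩ := ha
  obtain ⟨hb1, hb2⟩ := hb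
  have ht' : S.get .tmp = [] := ht
  have hu' : S.get .aux = [] := hu
  rw [Bool.true_and] at h1
  refine Runs.of_eq (h1.bind ((runs_moveTo ha1.symm (l := (S.get a).reverse) ?_).bind
    ((runs_moveTo hb2.symm (l := (S.get b).reverse) ?_).bind (runs_ret _ _)))) ?_ ?_
  · simp [St.get_set, *]
  · simp [St.get_set, ha2.symm, *]
  · refine St.ext_get fun c => ?_
    simp only [St.get_set]
    grind
  · simp only [List.length_reverse]
    omega

end Routines

/-! ### Encodings -/

theorem encNat_injective : Function.Injective encNat := by
  intro m n h
  have h1 : encodeNat m = encodeNat n :=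
    List.map_injective_iff.2 (fun a b h => by cases h; rfl) h
  rw [← decode_encodeNat m, h1, decode_encodeNat]

/-- The word of a candidate, reversed. -/
def revWord (n : ℕ) : List Γ' := (encNat n).reverse

theorem revWord_inj {m n : ℕ} : revWord m = revWord n ↔ m = n :=
  ⟨fun h => encNat_injective (List.reverse_injective h), fun h => h ▸ rfl⟩

/-- The entries of a list of candidates, each followed by a comma. -/
def entries (l : List ℕ) : List Γ' := l.flatMap fun n => encNat n ++ [Γ'.comma]

theorem entries_cons (n : ℕ) (l : List ℕ) :
    entries (n :: l) = encNat n ++ Γ'.comma :: entries l := by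
  simp [entries]

theorem encCandidates_eq (C : Finset ℕ) :
    encCandidates C = Γ'.bra :: (entries (C.sort (· ≤ ·)) ++ [Γ'.ket]) := rfl

/-- This lets `readKet` find the end of a candidate set at the first `ket`. -/
theorem ket_notMem_entries (l : List ℕ) : Γ'.ket ∉ entries l := by
  simp [entries, encNat]

theorem length_entries (l : List ℕ) :
    (entries l).length = (l.map fun n => (encNat n).length + 1).sum := by
  induction l with
  | nil => rfl
  | cons n l ih =>
    rw [entries_cons]
    simp only [List.length_append, List.length_cons, ih, List.map_cons, List.sum_cons]
    omega

theorem length_encCandidates (C : Finset ℕ) :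
    (encCandidates C).length = ∑ n ∈ C, ((encNat n).length + 1) + 2 := by
  rw [encCandidates_eq, List.length_cons, List.length_append, length_entries]
  have : ((C.sort (· ≤ ·)).map fun n => (encNat n).length + 1).sum
      = ∑ n ∈ C, ((encNat n).length + 1) := by
    rw [← List.sum_toFinset _ (C.sort_nodup (· ≤ ·)), Finset.sort_toFinset]
  rw [this]
  rfl

theorem length_encCandidates_mono {C D : Finset ℕ} (h : C ⊆ D) :
    (encCandidates C).length ≤ (encCandidates D).length := by
  rw [length_encCandidates, length_encCandidates]
  exact Nat.add_le_add_right (Finset.sum_le_sum_of_subset h) 2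

/-- The adjacency matrix is a plain block of bits, so inside a list of votes it ends at the
separating comma. The parser need not know the number of candidates. -/
theorem exists_encTournament_eq (T : Tournament) :
    ∃ w : List Bool, encTournament T = encCandidates T.verts ++ w.map Γ'.bit := by
  classical
  refine ⟨(T.verts.sort (· ≤ ·)).flatMap fun a =>
    (T.verts.sort (· ≤ ·)).map fun b => decide (T.Beats a b), ?_⟩
  rw [List.map_flatMap]
  simp only [List.map_map]
  unfold encTournament
  rfl

/-- A subset lists some of the same names and has no matrix. The selected sets are thus bounded by
the input length, independently of the running time of `ts`. -/
theorem length_encCandidates_sel_le (ts : TournamentSolution) (T : Tournament) :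
    (encCandidates (ts.sel T)).length ≤ (encTournament T).length := by
  obtain ⟨w, hw⟩ := exists_encTournament_eq T
  rw [hw, List.length_append]
  exact (length_encCandidates_mono (ts.subset T)).trans (Nat.le_add_right _ _)

/-! ### Binary numerals -/

/-- The value of a binary numeral, least significant bit first. -/
def bitsVal : List Bool → ℕ
  | [] => 0
  | b :: l => b.toNat + 2 * bitsVal l

theorem bitsVal_encodePosNum (n : PosNum) : bitsVal (encodePosNum n) = n := by
  induction n with
  | one => rfl
  | bit0 n ih =>
    simp only [encodePosNum, bitsVal, ih, PosNum.cast_bit0]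
    simp
    omega
  | bit1 n ih =>
    simp only [encodePosNum, bitsVal, ih, PosNum.cast_bit1]
    simp
    omega

theorem bitsVal_encodeNat (n : ℕ) : bitsVal (encodeNat n) = n := by
  unfold encodeNat encodeNum
  conv_rhs => rw [← Num.to_of_nat n]
  cases (n : Num) with
  | zero => rfl
  | pos m => exact bitsVal_encodePosNum m

theorem bitsVal_replicate_false (n : ℕ) : bitsVal (List.replicate n false) = 0 := by
  induction n with
  | zero => rfl
  | succ n ih => simp [List.replicate_succ, bitsVal, ih]

/-- This is `2 ^ j = (1 + 2 + ⋯ + 2 ^ (j - 1)) + 1`: borrowing from the lowest set bit turns the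
zeros below it into ones. -/
theorem bitsVal_borrow (j : ℕ) (r : List Bool) :
    bitsVal (List.replicate j false ++ true :: r)
      = bitsVal (List.replicate j true ++ false :: r) + 1 := by
  induction j with
  | zero => simp [bitsVal]; omega
  | succ n ih =>
    simp only [List.replicate_succ, List.cons_append, bitsVal, ih]
    simp
    omega

theorem eq_replicate_false_or (w : List Bool) :
    (∃ j, w = List.replicate j false) ∨ ∃ j r, w = List.replicate j false ++ true :: r := by
  induction w with
  | nil => exact .inl ⟨0, rfl⟩
  | cons b w ih =>
    cases b with
    | true => exact .inr ⟨0, w, rfl⟩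
    | false =>
      rcases ih with ⟨j, rfl⟩ | ⟨j, r, rfl⟩
      · exact .inl ⟨j + 1, rfl⟩
      · exact .inr ⟨j + 1, r, rfl⟩

section Routines

variable {M : FinTM2}

/-! ### Decrementing a binary counter -/

/-- Search the lowest bit of `num` that is set, and borrow from it. -/
def borrowLoop : Prog M Bool :=
  .iter (A := Unit) (fun _ => (pop .num).bind fun
    | some (.bit true) => (push .num (.bit false)).bind fun _ => .ret (.inr true)
    | some (.bit false) => (push .tmp (.bit true)).bind fun _ => .ret (.inl ())
    | _ => .ret (.inr false)) ()

/-- Decrement `num`, and tell whether it was positive. -/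
def decrement : Prog M Bool :=
  borrowLoop.bind fun
    | true => (moveTo .tmp .num).bind fun _ => .ret true
    | false => (clear .tmp).bind fun _ => .ret false

theorem runs_borrowLoop_zero (j : ℕ) {S : St}
    (h : S.num = (List.replicate j false).map Γ'.bit) :
    Runs (M := M) borrowLoop S false
      { S with num := [], tmp := List.replicate j (Γ'.bit true) ++ S.tmp } (4 * j + 3) := by
  induction j generalizing S with
  | zero =>
    refine Runs.of_eq (n := 3) (Runs.iter_exit (n := 2)
      ((runs_pop_nil (a := .num) h).bind (m := 0) (runs_ret _ _))) ?_ (by simp)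
    cases S
    simp_all
  | succ j ih =>
    refine Runs.of_eq (Runs.iter_next (a' := ()) (n := 3)
      ((runs_pop_cons (a := .num) h).bind (m := 1)
        ((runs_push .tmp _ _).bind (m := 0) (runs_ret _ _))) (ih rfl)) ?_ (by omega)
    simp [List.replicate_succ', St.set, St.get]

theorem runs_borrowLoop_pos (j : ℕ) {r : List Bool} {S : St}
    (h : S.num = (List.replicate j false ++ true :: r).map Γ'.bit) :
    Runs (M := M) borrowLoop S true
      { S with num := (false :: r).map Γ'.bit,
               tmp := List.replicate j (Γ'.bit true) ++ S.tmp } (4 * j + 4) := by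
  induction j generalizing S with
  | zero =>
    exact Runs.iter_exit (n := 3) ((runs_pop_cons (a := .num) h).bind (m := 1)
        ((runs_push .num _ _).bind (m := 0) (runs_ret _ _)))
  | succ j ih =>
    refine Runs.of_eq (Runs.iter_next (a' := ()) (n := 3)
      ((runs_pop_cons (a := .num) h).bind (m := 1)
        ((runs_push .tmp _ _).bind (m := 0) (runs_ret _ _))) (ih rfl)) ?_ (by omega)
    simp [List.replicate_succ', St.set, St.get]

/-- Borrowing can leave leading zeros, so the new numeral need not be the canonical one; only its
value and a bound on its length are recorded. From the value zero the result is the empty numeral,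
in agreement with truncated subtraction. -/
theorem runs_decrement {w : List Bool} {S : St} (h : S.num = w.map Γ'.bit) (ht : S.tmp = []) :
    ∃ w' : List Bool, bitsVal w' = bitsVal w - 1 ∧ w'.length ≤ w.length ∧
      Runs (M := M) decrement S (decide (0 < bitsVal w)) { S with num := w'.map Γ'.bit }
        (8 * w.length + 8) := by
  rcases eq_replicate_false_or w with ⟨j, rfl⟩ | ⟨j, r, rfl⟩
  · refine ⟨[], by simp [bitsVal, bitsVal_replicate_false], by simp, ?_⟩
    rw [bitsVal_replicate_false]
    have h1 := runs_borrowLoop_zero (M := M) j h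
    have h2 := runs_clear (M := M) (a := .tmp) (l := List.replicate j (Γ'.bit true))
      (S := { S with num := [], tmp := List.replicate j (Γ'.bit true) ++ S.tmp })
      (by simp [St.get, ht])
    refine Runs.of_eq (h1.bind (e' := false) (h2.bind (m := 0) (runs_ret _ _))) ?_ ?_
    · simp [St.set, ht]
    · simp; omega
  · refine ⟨List.replicate j true ++ false :: r, by rw [bitsVal_borrow]; rfl, by simp, ?_⟩
    have e : decide (0 < bitsVal (List.replicate j false ++ true :: r)) = true := by
      rw [bitsVal_borrow]
      simp
    rw [e]
    have h1 := runs_borrowLoop_pos (M := M) j h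
    have h2 := runs_moveTo (M := M) (a := .tmp) (b := .num) (by decide)
      (l := List.replicate j (Γ'.bit true))
      (S := { S with num := (false :: r).map Γ'.bit,
                     tmp := List.replicate j (Γ'.bit true) ++ S.tmp }) (by simp [St.get, ht])
    refine Runs.of_eq (h1.bind (e' := true) (h2.bind (m := 0) (runs_ret _ _))) ?_ ?_
    · simp [St.set, St.get, ht]
    · simp; omega

/-! ### Applying the tournament solution to a list of votes -/

/-- Replace the list of votes on `inp` by the selected sets, which are put on the stack `a`. If
`cap` is set, decrement `num` for every vote, and mark each success on `quota`. -/
def convert (α : M.Γ M.k₀ ≃ Γ') (β : M.Γ M.k₁ ≃ Γ') (a : Nm) (cap : Bool) : Prog M Unit :=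
  .iter (A := Unit) (fun _ => (pop .inp).bind fun
    | some .bra => (push .tmp .bra).bind fun _ => (readKet .inp .tmp).bind fun _ =>
        (readBits .inp .tmp).bind fun _ => (callSub α β).bind fun _ => (moveTo .aux a).bind fun _ =>
        if cap then decrement.bind fun
          | true => (push .quota .blank).bind fun _ => .ret (.inl ())
          | false => .ret (.inl ())
        else .ret (.inl ())
    | _ => .ret (.inr ())) ()

/-- Marks that represent a number in unary. -/
def marks (n : ℕ) : List Γ' := List.replicate n Γ'.blank

theorem marks_add (m n : ℕ) : marks (m + n) = marks m ++ marks n := List.replicate_add ..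

theorem length_marks (n : ℕ) : (marks n).length = n := List.length_replicate

/-- The number of marks that `convert` makes for `n` votes when `num` has the value `k`. -/
def quotaMarks (cap : Bool) (k n : ℕ) : ℕ := if cap then min k n else 0

/-- The selected sets of a list of votes, as listed by `convert`. -/
def selections (ts : TournamentSolution) (votes : List Tournament) : List Γ' :=
  (votes.reverse.map ts.sel).flatMap encCandidates

theorem selections_cons (ts : TournamentSolution) (T : Tournament) (votes : List Tournament) :
    selections ts (T :: votes) = selections ts votes ++ encCandidates (ts.sel T) := by
  simp [selections]

/-- The stacks after `convert`. -/
def St.converted (S : St) (ts : TournamentSolution) (a : Nm) (votes : List Tournament)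
    (r : List Γ') (w : List Bool) (n : ℕ) : St :=
  { S with inp := r, num := w.map Γ'.bit, quota := marks n ++ S.quota }.set a
    (selections ts votes ++ S.get a)

/-- One decrement per vote succeeds as long as the counter is positive, so `n` votes and a counter
of value `k` leave `min k n` marks. The selected sets pile up on `a` in reverse order of the votes,
which does not affect counts. -/
theorem runs_convert {ts : TournamentSolution} {α : M.Γ M.k₀ ≃ Γ'} {β : M.Γ M.k₁ ≃ Γ'}
    {N τ : ℕ} {a : Nm} (ha : a = .votes₁ ∨ a = .votes₂) (cap : Bool) {votes : List Tournament}
    (hsub : ∀ T ∈ votes, Nonempty (TM2OutputsInTime M ((encTournament T).map α.symm)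
      (some ((encCandidates (ts.sel T)).map β.symm)) τ))
    (hN : ∀ T ∈ votes, (encTournament T).length ≤ N) {w : List Bool} (hw : w.length ≤ N)
    {r : List Γ'} {S : St} (hnum : S.num = w.map Γ'.bit) (ht : S.tmp = []) (hu : S.aux = [])
    (hi : S.inp = (votes.flatMap fun T => encTournament T ++ [Γ'.comma]) ++ Γ'.ket :: r) :
    ∃ w' : List Bool, w'.length ≤ N ∧ (cap = false → w' = w) ∧ Runs (convert α β a cap) S ()
      (S.converted ts a votes r w' (quotaMarks cap (bitsVal w) votes.length))
      (votes.length * (28 * N + τ + 40) + 3) := by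
  induction votes generalizing S w with
  | nil =>
    refine ⟨w, hw, fun _ => rfl, Runs.of_eq (n := 3) (Runs.iter_exit (n := 2)
      ((runs_pop_cons (a := .inp) hi).bind (m := 0) (runs_ret _ _))) ?_ (by simp)⟩
    rcases ha with rfl | rfl <;>
      simp [St.converted, selections, quotaMarks, marks, St.set, St.get, ← hnum]
  | cons T votes ih =>
    obtain ⟨v, hv⟩ := exists_encTournament_eq T
    obtain ⟨hT⟩ := hsub T (by simp)
    have hNT := hN T (by simp)
    have hsel := length_encCandidates_sel_le ts T
    set rest : List Γ' := (votes.flatMap fun T => encTournament T ++ [Γ'.comma]) ++ Γ'.ket :: r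
      with hrest
    set body := entries (T.verts.sort (· ≤ ·)) with hbody
    have hi' : S.inp = Γ'.bra :: (body ++ Γ'.ket :: (v.map Γ'.bit ++ Γ'.comma :: rest)) := by
      rw [hi, List.flatMap_cons, hv, encCandidates_eq]
      simp [hrest, hbody]
    have hlen : (encTournament T).length = body.length + v.length + 2 := by
      rw [hv, encCandidates_eq]
      simp only [List.length_append, List.length_cons, List.length_map, List.length_nil, ← hbody]
      omega
    have h1 : Runs (M := M) (pop .inp) S (some .bra)
        { S with inp := body ++ Γ'.ket :: (v.map Γ'.bit ++ Γ'.comma :: rest) } 2 :=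
      runs_pop_cons (a := .inp) hi'
    have h2 : Runs (M := M) (push .tmp .bra)
        { S with inp := body ++ Γ'.ket :: (v.map Γ'.bit ++ Γ'.comma :: rest) } ()
        { S with inp := body ++ Γ'.ket :: (v.map Γ'.bit ++ Γ'.comma :: rest),
                 tmp := [Γ'.bra] } 1 :=
      (runs_push .tmp .bra _).of_eq (by simp [St.set, St.get, ht]) le_rfl
    have h3 := runs_readKet (M := M) (a := .inp) (b := .tmp) (by decide) (l := body)
      (r := v.map Γ'.bit ++ Γ'.comma :: rest)
      (S := { S with inp := body ++ Γ'.ket :: (v.map Γ'.bit ++ Γ'.comma :: rest),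
                     tmp := [Γ'.bra] }) rfl (ket_notMem_entries _)
    have h4 := runs_readBits (M := M) (a := .inp) (b := .tmp) (by decide) (w := v)
      (r := Γ'.comma :: rest)
      (S := { S with inp := v.map Γ'.bit ++ Γ'.comma :: rest,
                     tmp := Γ'.ket :: (body.reverse ++ [Γ'.bra]) }) rfl (by simp)
    have h5 := runs_callSub hT
      (S := { S with inp := rest,
                     tmp := (v.map Γ'.bit).reverse ++ Γ'.ket :: (body.reverse ++ [Γ'.bra]) })
      (by simp [hv, encCandidates_eq, hbody])
    set S₀ : St :=
      { S with inp := rest, tmp := [], aux := (encCandidates (ts.sel T)).reverse ++ S.aux }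
      with hS₀
    have h6 := runs_moveTo (M := M) (a := .aux) (b := a) (by rcases ha with rfl | rfl <;> decide)
      (l := (encCandidates (ts.sel T)).reverse) (S := S₀) (by simp [hS₀, St.get, hu])
    set S₁ : St := { S with inp := rest, tmp := [], aux := [] }.set a
      (encCandidates (ts.sel T) ++ S.get a) with hS₁
    have e6 : (S₀.set .aux []).set a ((encCandidates (ts.sel T)).reverse.reverse ++ S₀.get a)
        = S₁ := by
      rcases ha with rfl | rfl <;> simp [hS₀, hS₁, St.set, St.get]
    rw [e6] at h6
    have ht₁ : S₁.tmp = [] := by rcases ha with rfl | rfl <;> rfl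
    have hu₁ : S₁.aux = [] := by rcases ha with rfl | rfl <;> rfl
    have hi₁ : S₁.inp = rest := by rcases ha with rfl | rfl <;> rfl
    have hq₁ : S₁.quota = S.quota := by rcases ha with rfl | rfl <;> rfl
    have hn₁ : S₁.num = w.map Γ'.bit := by rcases ha with rfl | rfl <;> exact hnum
    -- The remaining votes, for any counter `w₂` and any number `k` of marks just made that add up
    -- to the required total.
    have hvotes : ∀ (S₂ : St) (w₂ : List Bool) (k : ℕ), w₂.length ≤ N →
        S₂ = { S₁ with num := w₂.map Γ'.bit, quota := marks k ++ S.quota } →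
        quotaMarks cap (bitsVal w₂) votes.length + k =
          quotaMarks cap (bitsVal w) (votes.length + 1) →
        ∃ w' : List Bool, w'.length ≤ N ∧ (cap = false → w' = w₂) ∧ Runs (convert α β a cap) S₂ ()
          (S.converted ts a (T :: votes) r w' (quotaMarks cap (bitsVal w) (votes.length + 1)))
          (votes.length * (28 * N + τ + 40) + 3) := by
      rintro S₂ w₂ k hw₂ hS₂ hk
      obtain ⟨w', hw', hc, hr⟩ := ih (fun T h => hsub T (by simp [h]))
        (fun T h => hN T (by simp [h])) hw₂ (S := S₂) (by rw [hS₂])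
        (by rw [hS₂]; exact ht₁) (by rw [hS₂]; exact hu₁)
        (by rw [hS₂]; exact hi₁)
      refine ⟨w', hw', hc, Runs.of_eq hr ?_ le_rfl⟩
      rw [hS₂, ← hk]
      unfold St.converted
      rw [marks_add, selections_cons]
      rcases ha with rfl | rfl <;>
        simp [hS₁, St.set, St.get, ht, hu]
    have hlenT : (T :: votes).length = votes.length + 1 := rfl
    -- The part of a round common to all cases: cutting out the vote, calling the subroutine and
    -- storing the selected set.
    have hone : ∀ (S₂ : St), Runs (M := M) (if cap then decrement.bind fun
          | true => (push .quota .blank).bind fun _ => .ret (.inl ())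
          | false => .ret (.inl ())
        else .ret (.inl () : Unit ⊕ Unit)) S₁ (.inl ()) S₂ (8 * N + 9) →
        Runs (M := M) ((pop .inp).bind fun
    | some .bra => (push .tmp .bra).bind fun _ => (readKet .inp .tmp).bind fun _ =>
        (readBits .inp .tmp).bind fun _ => (callSub α β).bind fun _ => (moveTo .aux a).bind fun _ =>
        if cap then decrement.bind fun
          | true => (push .quota .blank).bind fun _ => .ret (.inl ())
          | false => .ret (.inl ())
        else .ret (.inl ())
    | _ => .ret (.inr () : Unit ⊕ Unit)) S (.inl ()) S₂ (28 * N + τ + 39) := by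
      intro S₂ h7
      refine (h1.bind (h2.bind (h3.bind (h4.bind (h5.bind (h6.bind h7)))))).mono ?_
      simp only [List.length_reverse]
      omega
    rw [hlenT]
    cases cap with
    | false =>
      obtain ⟨w', hw', hc, hr⟩ := hvotes S₁ w 0 hw (by rw [← hn₁, ← hq₁]; rfl) rfl
      refine ⟨w', hw', hc, (Runs.iter_next (hone S₁ ((runs_ret _ _).mono (by omega))) hr).mono ?_⟩
      rw [Nat.add_mul]
      omega
    | true =>
      obtain ⟨w₂, hv₂, hl₂, hr₂⟩ := runs_decrement (M := M) hn₁ ht₁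
      by_cases hpos : 0 < bitsVal w
      · rw [decide_eq_true hpos] at hr₂
        have hp := runs_push (M := M) .quota .blank { S₁ with num := w₂.map Γ'.bit }
        -- For `k > 0` the count obeys `min (k - 1) n + 1 = min k (n + 1)`.
        obtain ⟨w', hw', hc, hr⟩ := hvotes _ w₂ 1 (hl₂.trans hw) (by rw [← hq₁])
          (by simp only [quotaMarks, if_true]; omega)
        refine ⟨w', hw', nofun, (Runs.iter_next (hone _ (Runs.mono (hr₂.bind (m := 1)
          (hp.bind (m := 0) (runs_ret _ _))) (by omega))) hr).mono ?_⟩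
        rw [Nat.add_mul]
        omega
      · rw [decide_eq_false hpos] at hr₂
        obtain ⟨w', hw', hc, hr⟩ := hvotes { S₁ with num := w₂.map Γ'.bit }
          w₂ 0 (hl₂.trans hw) (by rw [← hq₁]; rfl) (by simp only [quotaMarks, if_true]; omega)
        refine ⟨w', hw', nofun, (Runs.iter_next (hone _
          (Runs.mono (hr₂.bind (m := 0) (runs_ret _ _)) (by omega))) hr).mono ?_⟩
        rw [Nat.add_mul]
        omega

/-! ### Counting votes -/

/-- Read the selected sets on the stack `a`, moving them to `bak`, and mark on `elig` those for
which `test` holds for the statements that `cand` and `fav` are selected. The two flags tell whether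
`cand` and `fav` occurred in the current set. -/
def scanLoop (a : Nm) (test : Bool → Bool → Bool) (v : Bool × Bool) : Prog M Unit :=
  .iter (A := Bool × Bool) (fun v => (pop a).bind fun
    | none => .ret (.inr ())
    | some (.bit s) => (push .bak (.bit s)).bind fun _ => (push .word (.bit s)).bind fun _ =>
        .ret (.inl v)
    | some .comma => (push .bak .comma).bind fun _ => (eqTest .word .cand).bind fun r =>
        (eqTest .word .fav).bind fun r' => (clear .word).bind fun _ =>
        .ret (.inl (v.1 || r, v.2 || r'))
    | some .ket => (push .bak .ket).bind fun _ =>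
        if test v.1 v.2 then (push .elig .blank).bind fun _ => .ret (.inl (false, false))
        else .ret (.inl (false, false))
    | some s => (push .bak s).bind fun _ => .ret (.inl (false, false))) v

/-- `Runs` describes a loop only up to its exit, so an initial part of the scan is expressed as a
prefix: a run from the later stacks extends backwards to one from the present stacks. The next two
lemmas have the same form. -/
theorem runs_scanLoop_bits {a : Nm} (ha : a = .votes₁ ∨ a = .votes₂) {test : Bool → Bool → Bool}
    {v : Bool × Bool} {w : List Bool} {r : List Γ'} {S S' : St} {n : ℕ}
    (h : S.get a = w.map Γ'.bit ++ r)
    (hr : Runs (M := M) (scanLoop a test v)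
      ({ S with bak := (w.map Γ'.bit).reverse ++ S.bak,
                word := (w.map Γ'.bit).reverse ++ S.word }.set a r) () S' n) :
    Runs (M := M) (scanLoop a test v) S () S' (5 * w.length + n) := by
  induction w generalizing S with
  | nil =>
    have e : S.set a r = S := by
      rw [show r = S.get a from h.symm, St.set_get]
    change Runs (M := M) (scanLoop a test v) (S.set a r) () S' n at hr
    rw [e] at hr
    exact hr.mono (by simp)
  | cons s w ih =>
    set S₁ := S.set a (w.map Γ'.bit ++ r) with hS₁
    have h1 : Runs (M := M) (pop a) S (some (.bit s)) S₁ 2 := runs_pop_cons h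
    have h2 := runs_push (M := M) .bak (.bit s) S₁
    set S₂ := S₁.set .bak (.bit s :: S₁.get .bak) with hS₂
    have h3 := runs_push (M := M) .word (.bit s) S₂
    refine Runs.mono (Runs.iter_next (a' := v) (n := 4) (h1.bind (m := 2)
      (h2.bind (m := 1) (h3.bind (m := 0) (runs_ret _ _)))) (ih ?_ ?_)) (by simp; omega)
    · rcases ha with rfl | rfl <;> rfl
    · rcases ha with rfl | rfl <;> simpa [hS₁, hS₂, St.set, St.get] using hr

/-- The word collected bit by bit is reversed, and so are the names on `cand` and `fav`; equality of
the stacks is then equality of the candidates by `revWord_inj`. -/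
theorem runs_scanLoop_entry {a : Nm} (ha : a = .votes₁ ∨ a = .votes₂) {test : Bool → Bool → Bool}
    {v : Bool × Bool} {c d p : ℕ} {r : List Γ'} {S S' : St} {n N : ℕ}
    (h : S.get a = encNat c ++ Γ'.comma :: r)
    (hd : S.cand = revWord d) (hp : S.fav = revWord p) (hword : S.word = []) (ht : S.tmp = [])
    (hu : S.aux = []) (hcN : (encNat c).length ≤ N) (hdN : (encNat d).length ≤ N)
    (hpN : (encNat p).length ≤ N)
    (hr : Runs (M := M) (scanLoop a test (v.1 || decide (c = d), v.2 || decide (c = p)))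
      ({ S with bak := (encNat c ++ [Γ'.comma]).reverse ++ S.bak }.set a r) () S' n) :
    Runs (M := M) (scanLoop a test v) S () S' (((encNat c).length + 1) * (50 * N + 50) + n) := by
  have hlen : (encodeNat c).length = (encNat c).length := by simp [encNat]
  refine Runs.mono (runs_scanLoop_bits ha (w := encodeNat c) h
    (n := 47 * N + 29 + n + 1) ?_) ?_
  · set S₁ : St := { S with bak := ((encodeNat c).map Γ'.bit).reverse ++ S.bak,
                            word := ((encodeNat c).map Γ'.bit).reverse ++ S.word }.set a
                              (Γ'.comma :: r) with hS₁
    set S₂ : St := { S with bak := Γ'.comma :: ((encNat c).reverse ++ S.bak),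
                            word := revWord c }.set a r with hS₂
    have h1 : Runs (M := M) (pop a) S₁ (some .comma) (S₁.set a r) 2 :=
      runs_pop_cons (by simp [hS₁])
    have h2 : Runs (M := M) (push .bak .comma) (S₁.set a r) () S₂ 1 := by
      refine (runs_push .bak .comma _).of_eq ?_ le_rfl
      rcases ha with rfl | rfl <;> simp [hS₁, hS₂, St.set, St.get, hword, revWord, encNat]
    have h3 : Runs (M := M) (eqTest .word .cand) S₂ (decide (c = d)) S₂ (22 * N + 11) := by
      have := runs_eqTest (M := M) (a := .word) (b := .cand) (S := S₂) (by decide) (by decide)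
        (by decide) (by rcases ha with rfl | rfl <;> exact ht)
        (by rcases ha with rfl | rfl <;> exact hu)
      have e1 : S₂.get .word = revWord c := by rcases ha with rfl | rfl <;> rfl
      have e2 : S₂.get .cand = revWord d := by rcases ha with rfl | rfl <;> exact hd
      rw [e1, e2] at this
      simp only [revWord_inj] at this
      refine this.mono ?_
      simp only [revWord, List.length_reverse]
      omega
    have h4 : Runs (M := M) (eqTest .word .fav) S₂ (decide (c = p)) S₂ (22 * N + 11) := by
      have := runs_eqTest (M := M) (a := .word) (b := .fav) (S := S₂) (by decide) (by decide)
        (by decide) (by rcases ha with rfl | rfl <;> exact ht)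
        (by rcases ha with rfl | rfl <;> exact hu)
      have e1 : S₂.get .word = revWord c := by rcases ha with rfl | rfl <;> rfl
      have e2 : S₂.get .fav = revWord p := by rcases ha with rfl | rfl <;> exact hp
      rw [e1, e2] at this
      simp only [revWord_inj] at this
      refine this.mono ?_
      simp only [revWord, List.length_reverse]
      omega
    have h5 : Runs (M := M) (clear .word) S₂ ()
        ({ S with bak := (encNat c ++ [Γ'.comma]).reverse ++ S.bak }.set a r) (3 * N + 3) := by
      refine (runs_clear (l := revWord c) (by rcases ha with rfl | rfl <;> rfl)).of_eq ?_ ?_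
      · rcases ha with rfl | rfl <;> simp [hS₂, St.set, hword]
      · simp only [revWord, List.length_reverse]
        omega
    have h6 : Runs (M := M) ((clear .word).bind fun _ =>
        .ret (.inl (v.1 || decide (c = d), v.2 || decide (c = p)) : Bool × Bool ⊕ Unit)) S₂
        (.inl (v.1 || decide (c = d), v.2 || decide (c = p)))
        ({ S with bak := (encNat c ++ [Γ'.comma]).reverse ++ S.bak }.set a r) (3 * N + 3) :=
      h5.bind (m := 0) (runs_ret _ _)
    refine (Runs.iter_next (n := 47 * N + 28) (Runs.mono
      (n := 2 + (1 + (22 * N + 11 + (22 * N + 11 + (3 * N + 3)))))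
      (h1.bind (h2.bind (h3.bind (h4.bind h6)))) (by omega)) hr).mono (by omega)
  · rw [hlen]
    nlinarith

theorem runs_scanLoop_entries {a : Nm} (ha : a = .votes₁ ∨ a = .votes₂)
    {test : Bool → Bool → Bool} {v : Bool × Bool} {cs : List ℕ} {d p : ℕ} {r : List Γ'}
    {S S' : St} {n N : ℕ} (h : S.get a = entries cs ++ r)
    (hd : S.cand = revWord d) (hp : S.fav = revWord p) (hword : S.word = []) (ht : S.tmp = [])
    (hu : S.aux = []) (hcN : (entries cs).length ≤ N) (hdN : (encNat d).length ≤ N)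
    (hpN : (encNat p).length ≤ N)
    (hr : Runs (M := M) (scanLoop a test (v.1 || decide (d ∈ cs), v.2 || decide (p ∈ cs)))
      ({ S with bak := (entries cs).reverse ++ S.bak }.set a r) () S' n) :
    Runs (M := M) (scanLoop a test v) S () S' ((entries cs).length * (50 * N + 50) + n) := by
  induction cs generalizing S v with
  | nil =>
    have e : S.set a r = S := by
      rw [show r = S.get a from h.symm, St.set_get]
    have e' : ({ S with bak := (entries []).reverse ++ S.bak } : St).set a r = S := e
    rw [e'] at hr
    simpa using hr.mono (by omega)
  | cons c cs ih =>
    rw [entries_cons] at h hcN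
    simp only [List.length_append, List.length_cons] at hcN
    refine Runs.mono (runs_scanLoop_entry ha (c := c) (by simpa using h) hd hp hword ht hu
      (N := N) (by omega) hdN hpN (ih (by simp) ?_ ?_ ?_ ?_ ?_ (by omega) ?_)) ?_
    · rcases ha with rfl | rfl <;> exact hd
    · rcases ha with rfl | rfl <;> exact hp
    · rcases ha with rfl | rfl <;> exact hword
    · rcases ha with rfl | rfl <;> exact ht
    · rcases ha with rfl | rfl <;> exact hu
    · have e : ((v.1 || decide (c = d)) || decide (d ∈ cs),
          (v.2 || decide (c = p)) || decide (p ∈ cs))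
          = (v.1 || decide (d ∈ c :: cs), v.2 || decide (p ∈ c :: cs)) := by
        simp only [List.mem_cons, Bool.decide_or, Bool.or_assoc, eq_comm]
      simp only [e]
      rcases ha with rfl | rfl <;> simpa [St.set, entries_cons] using hr
    · rw [entries_cons]
      simp only [List.length_append, List.length_cons]
      nlinarith

theorem runs_scanLoop {a : Nm} (ha : a = .votes₁ ∨ a = .votes₂) {test : Bool → Bool → Bool}
    {vs : List (Finset ℕ)} {d p : ℕ} {S : St} {N : ℕ} (h : S.get a = vs.flatMap encCandidates)
    (hd : S.cand = revWord d) (hp : S.fav = revWord p) (hword : S.word = []) (ht : S.tmp = [])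
    (hu : S.aux = []) (hN : (vs.flatMap encCandidates).length ≤ N) (hdN : (encNat d).length ≤ N)
    (hpN : (encNat p).length ≤ N) :
    Runs (M := M) (scanLoop a test (false, false)) S ()
      ({ S with bak := (vs.flatMap encCandidates).reverse ++ S.bak,
                elig := marks (vs.countP fun v => test (decide (d ∈ v)) (decide (p ∈ v)))
                  ++ S.elig }.set a [])
      ((vs.flatMap encCandidates).length * (50 * N + 50) + 3) := by
  induction vs generalizing S with
  | nil =>
    refine Runs.of_eq (n := 3) (Runs.iter_exit (n := 2)
      ((runs_pop_nil h).bind (m := 0) (runs_ret _ _))) ?_ (by simp)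
    cases S
    rcases ha with rfl | rfl <;> simp_all [St.set, St.get, marks]
  | cons C vs ih =>
    rw [List.flatMap_cons, encCandidates_eq] at h hN
    simp only [List.length_append, List.length_cons, List.length_nil] at hN
    set l := vs.flatMap encCandidates with hl
    set cs := C.sort (· ≤ ·) with hcs
    have hmem : ∀ x, decide (x ∈ C) = decide (x ∈ cs) := fun x => by simp [hcs]
    set S₁ : St := { S with bak := Γ'.bra :: S.bak }.set a (entries cs ++ Γ'.ket :: l) with hS₁
    set S₂ : St := { S₁ with bak := (entries cs).reverse ++ S₁.bak }.set a (Γ'.ket :: l) with hS₂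
    set f := test (decide (d ∈ C)) (decide (p ∈ C)) with hf
    set S₃ : St := { S with bak := (encCandidates C).reverse ++ S.bak,
                            elig := (if f then [Γ'.blank] else []) ++ S.elig }.set a l with hS₃
    have h1 : Runs (M := M) (pop a) S (some .bra) (S.set a (entries cs ++ Γ'.ket :: l)) 2 :=
      runs_pop_cons (by simpa using h)
    have h2 : Runs (M := M) (push .bak .bra) (S.set a (entries cs ++ Γ'.ket :: l)) () S₁ 1 := by
      refine (runs_push .bak .bra _).of_eq ?_ le_rfl
      rcases ha with rfl | rfl <;> rfl
    have h3 : Runs (M := M) (pop a) S₂ (some .ket) (S₂.set a l) 2 :=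
      runs_pop_cons (by simp [hS₂])
    have h4 := runs_push (M := M) .bak .ket (S₂.set a l)
    have h5 : Runs (M := M) (if f then (push .elig .blank).bind fun _ =>
          .ret (.inl (false, false))
        else .ret (.inl (false, false) : Bool × Bool ⊕ Unit))
        ((S₂.set a l).set .bak (Γ'.ket :: (S₂.set a l).get .bak)) (.inl (false, false)) S₃ 1 := by
      cases hff : f with
      | true =>
        have h6 := runs_push (M := M) .elig .blank
          ((S₂.set a l).set .bak (Γ'.ket :: (S₂.set a l).get .bak))
        refine Runs.of_eq (h6.bind (m := 0) (runs_ret _ _)) ?_ le_rfl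
        rcases ha with rfl | rfl <;>
          simp [hS₁, hS₂, hS₃, hff, St.set, St.get, encCandidates_eq, hcs]
      | false =>
        refine (runs_ret _ _).of_eq ?_ (by omega)
        rcases ha with rfl | rfl <;>
          simp [hS₁, hS₂, hS₃, hff, St.set, St.get, encCandidates_eq, hcs]
    have hrec := ih (S := S₃) (by simp [hS₃]) (by rcases ha with rfl | rfl <;> exact hd)
      (by rcases ha with rfl | rfl <;> exact hp) (by rcases ha with rfl | rfl <;> exact hword)
      (by rcases ha with rfl | rfl <;> exact ht) (by rcases ha with rfl | rfl <;> exact hu)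
      (by omega)
    obtain ⟨S₄, hS₄⟩ : ∃ S₄ : St, S₄ = { S₃ with
        bak := l.reverse ++ S₃.bak
        elig := marks (vs.countP fun v => test (decide (d ∈ v)) (decide (p ∈ v))) ++ S₃.elig
          }.set a [] := ⟨_, rfl⟩
    rw [← hS₄] at hrec
    have hket : Runs (M := M) (scanLoop a test (decide (d ∈ cs), decide (p ∈ cs))) S₂ () S₄
        (4 + (l.length * (50 * N + 50) + 3) + 1) := by
      refine Runs.iter_next (h3.bind (m := 2) (h4.bind (m := 1) ?_)) hrec
      simp only [← hmem]
      exact h5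
    have hent := runs_scanLoop_entries (M := M) (v := (false, false)) (cs := cs)
      (r := Γ'.ket :: l) (S := S₁) (N := N) ha (by simp [hS₁])
      (by rcases ha with rfl | rfl <;> exact hd) (by rcases ha with rfl | rfl <;> exact hp)
      (by rcases ha with rfl | rfl <;> exact hword) (by rcases ha with rfl | rfl <;> exact ht)
      (by rcases ha with rfl | rfl <;> exact hu) (by omega) hdN hpN
      (by simpa only [Bool.false_or] using hket)
    refine Runs.of_eq (Runs.iter_next (n := 3) (h1.bind (m := 1) (h2.bind (m := 0)
      (runs_ret _ _))) hent) ?_ ?_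
    · have hm : marks ((C :: vs).countP fun v => test (decide (d ∈ v)) (decide (p ∈ v)))
          = marks (vs.countP fun v => test (decide (d ∈ v)) (decide (p ∈ v)))
            ++ if f then [Γ'.blank] else [] := by
        rw [List.countP_cons, marks_add, ← hf]
        cases f <;> rfl
      rw [hm, hS₄]
      rcases ha with rfl | rfl <;> simp [hS₃, St.set, hl]
    · rw [List.flatMap_cons, List.length_append, ← hl, encCandidates_eq]
      simp only [List.length_append, List.length_cons, List.length_nil, ← hcs]
      nlinarith

/-- Mark on `elig` the selected sets on the stack `a` for which `test` holds. -/
def scan (a : Nm) (test : Bool → Bool → Bool) : Prog M Unit :=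
  (scanLoop a test (false, false)).bind fun _ => moveTo .bak a

/-- The list is restored from `bak`, because it is scanned again for other counts and other
opponents. -/
theorem runs_scan {a : Nm} (ha : a = .votes₁ ∨ a = .votes₂) {test : Bool → Bool → Bool}
    {vs : List (Finset ℕ)} {d p : ℕ} {S : St} {N : ℕ} (h : S.get a = vs.flatMap encCandidates)
    (hd : S.cand = revWord d) (hp : S.fav = revWord p) (hword : S.word = []) (ht : S.tmp = [])
    (hu : S.aux = []) (hb : S.bak = []) (hN : (vs.flatMap encCandidates).length ≤ N)
    (hdN : (encNat d).length ≤ N) (hpN : (encNat p).length ≤ N) :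
    Runs (M := M) (scan a test) S ()
      { S with elig := marks (vs.countP fun v => test (decide (d ∈ v)) (decide (p ∈ v)))
                  ++ S.elig } (N * (50 * N + 54) + 6) := by
  refine Runs.of_eq ((runs_scanLoop ha h hd hp hword ht hu hN hdN hpN).bind
    (runs_moveTo (by rcases ha with rfl | rfl <;> decide)
      (l := (vs.flatMap encCandidates).reverse) ?_)) ?_ ?_
  · rcases ha with rfl | rfl <;> simp [St.set, St.get, hb]
  · rcases ha with rfl | rfl <;> simp [St.set, St.get, hb, ← h]
  · rw [List.length_reverse]
    nlinarith

/-! ### The test for a single opponent -/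

/-- Move marks from `elig` to `pos`, at most as many as there are on `quota`. -/
def capLoop : Prog M Unit :=
  .iter (A := Unit) (fun _ => (pop .elig).bind fun
    | none => .ret (.inr ())
    | some _ => (pop .quota).bind fun
      | none => .ret (.inr ())
      | some _ => (push .pos .blank).bind fun _ => (push .tmp .blank).bind fun _ =>
          .ret (.inl ())) ()

theorem marks_append_cons (n : ℕ) (l : List Γ') :
    marks n ++ Γ'.blank :: l = marks (n + 1) ++ l := by
  rw [marks_add, List.append_assoc]
  rfl

/-- The copy on `tmp` records how much of the quota was used, so that it can be refilled. If the
quota runs out, a mark of `elig` has already been popped in vain; the rest of `elig` is irrelevant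
and only bounded. -/
theorem runs_capLoop (e q : ℕ) {S : St} (he : S.elig = marks e) (hq : S.quota = marks q) :
    ∃ e' ≤ e, Runs (M := M) capLoop S ()
      { S with
        pos := marks (min e q) ++ S.pos
        tmp := marks (min e q) ++ S.tmp
        elig := marks e'
        quota := marks (q - e) } (7 * e + 5) := by
  induction e generalizing S q with
  | zero =>
    refine ⟨0, le_rfl, Runs.of_eq (n := 3) (Runs.iter_exit (n := 2)
      ((runs_pop_nil (a := .elig) he).bind (m := 0) (runs_ret _ _))) ?_ (by omega)⟩
    cases S
    simp_all [marks]
  | succ e ih =>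
    cases q with
    | zero =>
      have h1 : Runs (M := M) (pop .elig) S (some .blank) { S with elig := marks e } 2 :=
        runs_pop_cons (a := .elig) he
      have h2 : Runs (M := M) (pop .quota) { S with elig := marks e } none
        { S with elig := marks e } 2 := runs_pop_nil (a := .quota) hq
      refine ⟨e, by omega, Runs.of_eq (n := 5) (S' := { S with elig := marks e })
        (Runs.iter_exit (n := 4) (h1.bind (m := 2) ?_)) ?_ (by omega)⟩
      · refine h2.bind (m := 0) ?_
        exact runs_ret _ _
      · cases S
        simp_all [marks]
    | succ q =>
      have h1 : Runs (M := M) (pop .elig) S (some .blank) { S with elig := marks e } 2 :=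
        runs_pop_cons (a := .elig) he
      have h2 : Runs (M := M) (pop .quota) { S with elig := marks e } (some .blank)
          { S with elig := marks e, quota := marks q } 2 :=
        runs_pop_cons (a := .quota) hq
      have h3 := runs_push (M := M) .pos .blank { S with elig := marks e, quota := marks q }
      have h4 := runs_push (M := M) .tmp .blank
        { S with elig := marks e, quota := marks q, pos := Γ'.blank :: S.pos }
      obtain ⟨e', he', hr⟩ := ih q (S := { S with
        elig := marks e
        quota := marks q
        pos := Γ'.blank :: S.pos
        tmp := Γ'.blank :: S.tmp }) rfl rfl
      refine ⟨e', by omega, Runs.of_eq (Runs.iter_next (a' := ()) (n := 6) (h1.bind (m := 4)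
        (h2.bind (m := 2) (h3.bind (m := 1) (h4.bind (m := 0) (runs_ret _ _))))) hr) ?_
        (by omega)⟩
      simp only [marks_append_cons, Nat.add_sub_add_right, Nat.add_min_add_right]

/-- Compare the numbers of marks on `neg` and `pos`. -/
def lessLoop : Prog M Bool :=
  .iter (A := Unit) (fun _ => (pop .pos).bind fun
    | none => .ret (.inr false)
    | some _ => (pop .neg).bind fun
      | none => .ret (.inr true)
      | some _ => .ret (.inl ())) ()

/-- Since `pos` is popped first, equal numbers of marks give `false`: the comparison is strict. -/
theorem runs_lessLoop (x y : ℕ) {S : St} (hx : S.pos = marks x) (hy : S.neg = marks y) :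
    ∃ x' ≤ x, ∃ y' ≤ y, Runs (M := M) lessLoop S (decide (y < x))
      { S with pos := marks x', neg := marks y' } (5 * x + 5) := by
  induction x generalizing S y with
  | zero =>
    refine ⟨0, le_rfl, y, le_rfl, Runs.of_eq (n := 3) (Runs.iter_exit (n := 2)
      ((runs_pop_nil (a := .pos) hx).bind (m := 0) (runs_ret _ _))) ?_ (by omega)⟩
    cases S
    simp_all
  | succ x ih =>
    cases y with
    | zero =>
      have h1 : Runs (M := M) (pop .pos) S (some .blank) { S with pos := marks x } 2 :=
        runs_pop_cons (a := .pos) hx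
      have h2 : Runs (M := M) (pop .neg) { S with pos := marks x } none
        { S with pos := marks x } 2 := runs_pop_nil (a := .neg) hy
      refine ⟨x, by omega, 0, le_rfl, Runs.of_eq (n := 5) (S' := { S with pos := marks x })
        (Runs.iter_exit (n := 4) (h1.bind (m := 2) ?_)) ?_ (by omega)⟩
      · refine h2.bind (m := 0) ?_
        simp only [Nat.zero_lt_succ, decide_true]
        exact runs_ret _ _
      · cases S
        simp_all
    | succ y =>
      have h1 : Runs (M := M) (pop .pos) S (some .blank) { S with pos := marks x } 2 :=
        runs_pop_cons (a := .pos) hx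
      have h2 : Runs (M := M) (pop .neg) { S with pos := marks x } (some .blank)
          { S with pos := marks x, neg := marks y } 2 :=
        runs_pop_cons (a := .neg) hy
      obtain ⟨x', hx', y', hy', hr⟩ := ih y (S := { S with pos := marks x, neg := marks y })
        rfl rfl
      refine ⟨x', by omega, y', by omega, ?_⟩
      simp only [Nat.add_lt_add_iff_right]
      refine Runs.mono (Runs.iter_next (a' := ()) (n := 4) (h1.bind (m := 2) ?_) hr) (by omega)
      refine h2.bind (m := 0) ?_
      exact runs_ret _ _

/-- Test whether the candidate on `cand` can overtake the candidate on `fav` (if `strict` is set),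
or draw level with it (otherwise). -/
def evaluate (a : Nm) (test : Bool → Bool → Bool) (strict : Bool) : Prog M Bool :=
  (scan .votes₁ fun x _ => x).bind fun _ => (moveTo .elig .pos).bind fun _ =>
  (scan .votes₁ fun _ y => y).bind fun _ => (moveTo .elig .neg).bind fun _ =>
  (scan a test).bind fun _ => capLoop.bind fun _ => (moveTo .tmp .quota).bind fun _ =>
  (clear .elig).bind fun _ =>
  Frag.bind (if strict then .ret () else push .pos .blank) fun _ => lessLoop.bind fun r =>
  (clear .pos).bind fun _ => (clear .neg).bind fun _ => .ret r

/-- The outcome of `evaluate`, for the opponent `d` of `p`. -/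
def outcome (test : Bool → Bool → Bool) (strict : Bool) (vs vs' : List (Finset ℕ)) (q p d : ℕ) :
    Bool :=
  decide (vs.countP (fun v => decide (p ∈ v)) <
    min (vs'.countP fun v => test (decide (d ∈ v)) (decide (p ∈ v))) q +
      vs.countP (fun v => decide (d ∈ v)) + if strict then 0 else 1)

theorem length_le_length_flatMap_encCandidates (vs : List (Finset ℕ)) :
    vs.length ≤ (vs.flatMap encCandidates).length := by
  induction vs with
  | nil => simp
  | cons C vs ih =>
    rw [List.flatMap_cons, encCandidates_eq]
    simp only [List.length_append, List.length_cons]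
    omega

theorem runs_evaluate {a : Nm} (ha : a = .votes₁ ∨ a = .votes₂) {test : Bool → Bool → Bool}
    (strict : Bool) {vs vs' : List (Finset ℕ)} {d p q : ℕ} {S : St} {N : ℕ}
    (h : S.votes₁ = vs.flatMap encCandidates) (h' : S.get a = vs'.flatMap encCandidates)
    (hd : S.cand = revWord d) (hp : S.fav = revWord p) (hq : S.quota = marks q)
    (hword : S.word = []) (ht : S.tmp = [])
    (hu : S.aux = []) (hb : S.bak = []) (hx : S.pos = []) (hy : S.neg = []) (he : S.elig = [])
    (hN : (vs.flatMap encCandidates).length ≤ N) (hN' : (vs'.flatMap encCandidates).length ≤ N)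
    (hdN : (encNat d).length ≤ N) (hpN : (encNat p).length ≤ N) :
    Runs (M := M) (evaluate a test strict) S (outcome test strict vs vs' q p d) S
      (300 * (N + 1) ^ 2) := by
  set x := vs.countP (fun v => decide (d ∈ v)) with hxd
  set y := vs.countP (fun v => decide (p ∈ v)) with hyd
  set z := vs'.countP (fun v => test (decide (d ∈ v)) (decide (p ∈ v))) with hzd
  have hxN : x ≤ N :=
    (List.countP_le_length.trans (length_le_length_flatMap_encCandidates vs)).trans hN
  have hyN : y ≤ N :=
    (List.countP_le_length.trans (length_le_length_flatMap_encCandidates vs)).trans hN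
  have hzN : z ≤ N :=
    (List.countP_le_length.trans (length_le_length_flatMap_encCandidates vs')).trans hN'
  have h1 : Runs (M := M) (scan .votes₁ fun x _ => x) S () { S with elig := marks x }
      (N * (50 * N + 54) + 6) := by
    refine (runs_scan (.inl rfl) h hd hp hword ht hu hb hN hdN hpN).of_eq ?_ le_rfl
    simp [he, hxd]
  have h2 : Runs (M := M) (moveTo .elig .pos) { S with elig := marks x } ()
      { S with pos := marks x } (4 * x + 3) := by
    refine (runs_moveTo (by decide) (l := marks x) rfl).of_eq ?_ (by rw [length_marks])
    simp [St.set, St.get, hx, he, marks]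
  have h3 : Runs (M := M) (scan .votes₁ fun _ y => y) { S with pos := marks x } ()
      { S with pos := marks x, elig := marks y } (N * (50 * N + 54) + 6) := by
    refine (runs_scan (S := { S with pos := marks x }) (.inl rfl) h hd hp hword ht hu hb hN hdN
      hpN).of_eq ?_ le_rfl
    simp [he, hyd]
  have h4 : Runs (M := M) (moveTo .elig .neg) { S with pos := marks x, elig := marks y } ()
      { S with pos := marks x, neg := marks y } (4 * y + 3) := by
    refine (runs_moveTo (by decide) (l := marks y) rfl).of_eq ?_ (by rw [length_marks])
    simp [St.set, St.get, hy, he, marks]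
  have h5 : Runs (M := M) (scan a test) { S with pos := marks x, neg := marks y } ()
      { S with pos := marks x, neg := marks y, elig := marks z }
      (N * (50 * N + 54) + 6) := by
    refine (runs_scan (S := { S with pos := marks x, neg := marks y }) ha
      (by rcases ha with rfl | rfl <;> exact h') hd hp hword ht hu hb hN' hdN
      hpN).of_eq ?_ le_rfl
    simp [he, hzd]
  obtain ⟨z', hz', h6⟩ := runs_capLoop (M := M) z q
    (S := { S with pos := marks x, neg := marks y, elig := marks z }) rfl hq
  set S₆ : St := { S with
    pos := marks (min z q + x)
    neg := marks y
    elig := marks z'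
    quota := marks (q - z)
    tmp := marks (min z q) } with hS₆
  have e6 : { S with
      pos := marks (min z q) ++ marks x
      neg := marks y
      tmp := marks (min z q) ++ S.tmp
      elig := marks z'
      quota := marks (q - z) } = S₆ := by
    simp [hS₆, marks_add, ht]
  have h6' : Runs (M := M) capLoop { S with pos := marks x, neg := marks y, elig := marks z } ()
    S₆ (7 * z + 5) := h6.of_eq e6 le_rfl
  have h7 : Runs (M := M) (moveTo .tmp .quota) S₆ ()
      { S with pos := marks (min z q + x), neg := marks y, elig := marks z' }
      (4 * min z q + 3) := by
    refine (runs_moveTo (by decide) (l := marks (min z q)) rfl).of_eq ?_ (by rw [length_marks])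
    -- The quota is refilled: `min z q + (q - z) = q`.
    have : (marks (min z q)).reverse ++ marks (q - z) = S.quota := by
      rw [show (marks (min z q)).reverse = marks (min z q) from List.reverse_replicate ..,
        ← marks_add, hq]
      congr 1
      omega
    simp [St.set, St.get, hS₆, this, ht]
  have h8 : Runs (M := M) (clear .elig)
      { S with pos := marks (min z q + x), neg := marks y, elig := marks z' } ()
      { S with pos := marks (min z q + x), neg := marks y } (3 * z' + 3) := by
    refine (runs_clear (l := marks z') rfl).of_eq ?_ (by rw [length_marks])
    simp [St.set, he]
  -- One extra mark turns the strict comparison into a weak one.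
  set x₁ := min z q + x + if strict then 0 else 1 with hx₁
  have h9 : Runs (M := M) (if strict then .ret () else push .pos .blank)
      { S with pos := marks (min z q + x), neg := marks y } ()
      { S with pos := marks x₁, neg := marks y } 1 := by
    cases strict with
    | true => exact (runs_ret _ _).mono (by omega)
    | false => exact runs_push .pos .blank _
  obtain ⟨x', hx', y', hy', h10⟩ := runs_lessLoop (M := M) x₁ y
    (S := { S with pos := marks x₁, neg := marks y }) rfl rfl
  have h11 : Runs (M := M) (clear .pos) { S with pos := marks x', neg := marks y' } ()
      { S with neg := marks y' } (3 * x' + 3) := by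
    refine (runs_clear (l := marks x') rfl).of_eq ?_ (by rw [length_marks])
    simp [St.set, hx]
  have h12 : Runs (M := M) (clear .neg) { S with neg := marks y' } () S (3 * y' + 3) := by
    refine (runs_clear (l := marks y') rfl).of_eq ?_ (by rw [length_marks])
    cases S
    simp_all [St.set]
  have h13 : Runs (M := M) ((clear .neg).bind fun _ => .ret (decide (y < x₁)))
      { S with neg := marks y' } (decide (y < x₁)) S (3 * y' + 3) :=
    h12.bind (m := 0) (runs_ret _ _)
  have hx₁N : x₁ ≤ 2 * N + 1 := by
    rw [hx₁]
    split_ifs <;> omega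
  -- The three scans contribute the quadratic part `150 * N ^ 2`; everything else is linear in `N`.
  refine (h1.bind (h2.bind (h3.bind (h4.bind (h5.bind (h6'.bind (h7.bind (h8.bind (h9.bind
    (h10.bind (h11.bind h13))))))))))).mono ?_
  have : min z q ≤ z := min_le_left _ _
  nlinarith

/-! ### The loop over the opponents -/

/-- Test whether some candidate listed on `cands`, other than the one on `fav`, passes
`evaluate`. -/
def controlLoop (a : Nm) (test : Bool → Bool → Bool) (strict : Bool) : Prog M Bool :=
  .iter (A := Unit) (fun _ => (readBits .cands .cand).bind fun
    | some .comma => (eqTest .cand .fav).bind fun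
      | true => (clear .cand).bind fun _ => .ret (.inl ())
      | false => (evaluate a test strict).bind fun r => (clear .cand).bind fun _ =>
          .ret (if r then .inr true else .inl ())
    | _ => .ret (.inr false)) ()

/-- The answer of `controlLoop`. -/
def answer (test : Bool → Bool → Bool) (strict : Bool) (vs vs' : List (Finset ℕ)) (q p : ℕ)
    (cs : List ℕ) : Bool :=
  cs.any fun d => !decide (d = p) && outcome test strict vs vs' q p d

/-- The loop stops at the first successful opponent, so some candidates may remain on `cands`; a
bound on their length suffices for clearing the stack. All other stacks are restored after each
opponent. -/
theorem runs_controlLoop {a : Nm} (ha : a = .votes₁ ∨ a = .votes₂) {test : Bool → Bool → Bool}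
    (strict : Bool) {vs vs' : List (Finset ℕ)} {cs : List ℕ} {p q : ℕ} {S : St} {N : ℕ}
    (h : S.votes₁ = vs.flatMap encCandidates) (h' : S.get a = vs'.flatMap encCandidates)
    (hc : S.cands = entries cs) (hp : S.fav = revWord p) (hq : S.quota = marks q)
    (hd : S.cand = []) (hword : S.word = []) (ht : S.tmp = [])
    (hu : S.aux = []) (hb : S.bak = []) (hx : S.pos = []) (hy : S.neg = []) (he : S.elig = [])
    (hN : (vs.flatMap encCandidates).length ≤ N) (hN' : (vs'.flatMap encCandidates).length ≤ N)
    (hcN : (entries cs).length ≤ N) (hpN : (encNat p).length ≤ N) :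
    ∃ cs' : List ℕ, (entries cs').length ≤ N ∧
      Runs (M := M) (controlLoop a test strict) S (answer test strict vs vs' q p cs)
        { S with cands := entries cs' } (cs.length * (400 * (N + 1) ^ 2) + 5) := by
  induction cs generalizing S with
  | nil =>
    refine ⟨[], hcN, ?_⟩
    have h1 : Runs (M := M) (readBits .cands .cand) S none S 3 := by
      refine (runs_readBits (a := .cands) (b := .cand) (by decide) (w := []) (r := []) hc
        (by simp)).of_eq ?_ (by simp)
      cases S
      simp_all [St.set, St.get, entries]
    rw [← hc]
    refine Runs.mono (Runs.iter_exit (n := 3) (h1.bind (m := 0) ?_)) (by omega)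
    exact runs_ret _ _
  | cons d cs ih =>
    rw [entries_cons] at hc hcN
    simp only [List.length_append, List.length_cons] at hcN
    have hw : (encodeNat d).length ≤ N := by
      simp only [encNat, List.length_map] at hcN
      omega
    have hdN : (encNat d).length ≤ N := by omega
    have hrevN : (revWord d).length ≤ N := by simpa [revWord] using hdN
    set S₁ : St := { S with cands := entries cs, cand := revWord d } with hS₁
    have h1 : Runs (M := M) (readBits .cands .cand) S (some .comma) S₁ (4 * N + 3) := by
      refine (runs_readBits (a := .cands) (b := .cand) (by decide) (w := encodeNat d)
        (r := Γ'.comma :: entries cs) (by simpa [encNat, St.get] using hc)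
        (by simp)).of_eq ?_ (by omega)
      simp [St.set, St.get, hS₁, hd, revWord, encNat]
    have h2 : Runs (M := M) (eqTest .cand .fav) S₁ (decide (d = p)) S₁ (22 * N + 11) := by
      have := runs_eqTest (M := M) (a := .cand) (b := .fav) (S := S₁) (by decide) (by decide)
        (by decide) ht hu
      have e2 : S₁.get .fav = revWord p := hp
      have e1 : S₁.get .cand = revWord d := rfl
      rw [e1, e2] at this
      simp only [revWord_inj] at this
      refine this.mono ?_
      simp only [revWord, List.length_reverse]
      omega
    have h3 : Runs (M := M) (clear .cand) S₁ () { S with cands := entries cs } (3 * N + 3) := by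
      refine (runs_clear (l := revWord d) rfl).of_eq ?_ (by omega)
      simp [hS₁, St.set, hd]
    obtain ⟨cs', hcs', hr⟩ := ih (S := { S with cands := entries cs }) h
      (by rcases ha with rfl | rfl <;> exact h') rfl hp hq hd hword ht hu hb hx hy he (by omega)
    have hstep : ∀ n, (cs.length + 1) * (400 * (N + 1) ^ 2) + n
        = cs.length * (400 * (N + 1) ^ 2) + 400 * (N + 1) ^ 2 + n := fun n => by ring
    have hsq : N + 1 ≤ (N + 1) ^ 2 := by nlinarith
    by_cases hdp : d = p
    · have hans : answer test strict vs vs' q p (d :: cs) = answer test strict vs vs' q p cs := by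
        simp [answer, hdp]
      rw [hans]
      refine ⟨cs', hcs', ?_⟩
      rw [decide_eq_true hdp] at h2
      have h4 : Runs (M := M) ((clear .cand).bind fun _ => .ret (.inl () : Unit ⊕ Bool)) S₁
          (.inl ()) { S with cands := entries cs } (3 * N + 3) := h3.bind (m := 0) (runs_ret _ _)
      refine (Runs.iter_next (h1.bind (m := 22 * N + 11 + (3 * N + 3)) ?_) hr).mono ?_
      · exact h2.bind h4
      · rw [List.length_cons, hstep]
        omega
    · rw [decide_eq_false hdp] at h2
      have h5 := runs_evaluate (M := M) (S := S₁) (q := q) (test := test) (N := N) ha strict h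
        (by rcases ha with rfl | rfl <;> exact h') rfl hp hq hword ht hu hb hx hy he hN hN' hdN hpN
      have h4 : Runs (M := M) ((clear .cand).bind fun _ =>
            .ret (if outcome test strict vs vs' q p d then .inr true else .inl () : Unit ⊕ Bool)) S₁
          (if outcome test strict vs vs' q p d then .inr true else .inl ())
          { S with cands := entries cs } (3 * N + 3) := h3.bind (m := 0) (runs_ret _ _)
      cases hout : outcome test strict vs vs' q p d with
      | true =>
        have hans : answer test strict vs vs' q p (d :: cs) = true := by
          simp [answer, hdp, hout]
        rw [hans]
        refine ⟨cs, by omega, ?_⟩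
        rw [hout] at h4 h5
        refine (Runs.iter_exit (h1.bind
          (m := 22 * N + 11 + (300 * (N + 1) ^ 2 + (3 * N + 3))) ?_)).mono ?_
        · exact h2.bind (h5.bind h4)
        · rw [List.length_cons, hstep]
          omega
      | false =>
        have hans : answer test strict vs vs' q p (d :: cs)
            = answer test strict vs vs' q p cs := by
          simp [answer, hout]
        rw [hans]
        refine ⟨cs', hcs', ?_⟩
        rw [hout] at h4 h5
        refine (Runs.iter_next (h1.bind
          (m := 22 * N + 11 + (300 * (N + 1) ^ 2 + (3 * N + 3))) ?_) hr).mono ?_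
        · exact h2.bind (h5.bind h4)
        · rw [List.length_cons, hstep]
          omega

/-! ### Reading the head of an instance -/

/-- Read the distinguished candidate, the bound and the candidate set. -/
def header : Prog M Unit :=
  (readBits .inp .fav).bind fun _ => (readBits .inp .tmp).bind fun _ =>
  (moveTo .tmp .num).bind fun _ => (pop .inp).bind fun _ => (readKet .inp .tmp).bind fun _ =>
  (pop .tmp).bind fun _ => moveTo .tmp .cands

/-- The head of an instance. -/
def encHead (p k : ℕ) (C : Finset ℕ) : List Γ' :=
  encNat p ++ [Γ'.comma] ++ encNat k ++ [Γ'.comma] ++ encCandidates C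

theorem length_encHead (p k : ℕ) (C : Finset ℕ) : (encHead p k C).length
    = (encNat p).length + (encNat k).length + (entries (C.sort (· ≤ ·))).length + 4 := by
  rw [encHead, encCandidates_eq]
  simp only [List.length_append, List.length_cons, List.length_nil]
  omega

/-- The name of `p` is left reversed, matching the words read later. The bound is moved twice, so
that its lowest bit lies on top, ready for `decrement`. -/
theorem runs_header (p k : ℕ) (C : Finset ℕ) (r : List Γ') :
    Runs (M := M) header { inp := encHead p k C ++ r } ()
      { inp := r, fav := revWord p, num := encNat k, cands := entries (C.sort (· ≤ ·)) }
      (8 * (encHead p k C).length + 20) := by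
  have hi : encHead p k C ++ r = encNat p ++ Γ'.comma :: (encNat k ++ Γ'.comma ::
      Γ'.bra :: (entries (C.sort (· ≤ ·)) ++ Γ'.ket :: r)) := by
    simp [encHead, encCandidates_eq]
  have hlen := length_encHead p k C
  rw [hi]
  set l := entries (C.sort (· ≤ ·)) with hl
  set r₃ := l ++ Γ'.ket :: r with hr₃
  set r₂ := Γ'.bra :: r₃ with hr₂
  set r₁ := encNat k ++ Γ'.comma :: r₂ with hr₁
  have hep : (encodeNat p).length = (encNat p).length := by simp [encNat]
  have hek : (encodeNat k).length = (encNat k).length := by simp [encNat]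
  have h1 : Runs (M := M) (readBits .inp .fav) { inp := encNat p ++ Γ'.comma :: r₁ } (some .comma)
      { inp := r₁, fav := revWord p } (4 * (encNat p).length + 3) := by
    refine (runs_readBits (by decide) (w := encodeNat p) (r := Γ'.comma :: r₁) rfl
      (by simp)).of_eq ?_ (by omega)
    simp [St.set, St.get, revWord, encNat]
  have h2 : Runs (M := M) (readBits .inp .tmp) { inp := r₁, fav := revWord p } (some .comma)
      { inp := r₂, fav := revWord p, tmp := revWord k } (4 * (encNat k).length + 3) := by
    refine (runs_readBits (by decide) (w := encodeNat k) (r := Γ'.comma :: r₂) rfl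
      (by simp)).of_eq ?_ (by omega)
    simp [St.set, St.get, revWord, encNat]
  have h3 : Runs (M := M) (moveTo .tmp .num) { inp := r₂, fav := revWord p, tmp := revWord k } ()
      { inp := r₂, fav := revWord p, num := encNat k } (4 * (encNat k).length + 3) := by
    refine (runs_moveTo (by decide) (l := revWord k) rfl).of_eq ?_ (by simp [revWord])
    simp [St.set, St.get, revWord]
  have h4 : Runs (M := M) (pop .inp) { inp := r₂, fav := revWord p, num := encNat k }
      (some .bra) { inp := r₃, fav := revWord p, num := encNat k } 2 :=
    runs_pop_cons (a := .inp) rfl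
  have h5 : Runs (M := M) (readKet .inp .tmp) { inp := r₃, fav := revWord p, num := encNat k }
      () { inp := r, fav := revWord p, num := encNat k, tmp := Γ'.ket :: l.reverse }
      (4 * l.length + 4) := by
    refine (runs_readKet (by decide) rfl (ket_notMem_entries _)).of_eq ?_ le_rfl
    simp [St.set, St.get, hl]
  have h6 : Runs (M := M) (pop .tmp)
      { inp := r, fav := revWord p, num := encNat k, tmp := Γ'.ket :: l.reverse }
      (some .ket) { inp := r, fav := revWord p, num := encNat k, tmp := l.reverse } 2 :=
    runs_pop_cons (a := .tmp) rfl
  have h7 : Runs (M := M) (moveTo .tmp .cands)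
      { inp := r, fav := revWord p, num := encNat k, tmp := l.reverse } ()
      { inp := r, fav := revWord p, num := encNat k, cands := l } (4 * l.length + 3) := by
    refine (runs_moveTo (by decide) (l := l.reverse) rfl).of_eq ?_ (by simp)
    simp [St.set, St.get]
  refine (h1.bind (h2.bind (h3.bind (h4.bind (h5.bind (h6.bind h7)))))).mono ?_
  omega

/-! ### The decision programs -/

/-- All working stacks. -/
def allNames : List Nm :=
  [.inp, .fav, .num, .cands, .cand, .votes₁, .votes₂, .bak, .word, .tmp, .aux, .pos, .neg, .elig,
    .quota]

theorem runs_clearAll_allNames {N : ℕ} {S : St} (h : ∀ a, (S.get a).length ≤ N) :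
    Runs (M := M) (clearAll allNames) S () {} (15 * (3 * N + 3)) :=
  runs_clearAll N allNames S fun a _ => h a

/-- Decide destructive control by adding votes. -/
def solveAV (α : M.Γ M.k₀ ≃ Γ') (β : M.Γ M.k₁ ≃ Γ') (strict : Bool) : Prog M Bool :=
  header.bind fun _ => (pop .inp).bind fun _ => (convert α β .votes₁ false).bind fun _ =>
  (pop .inp).bind fun _ => (convert α β .votes₂ true).bind fun _ =>
  (controlLoop .votes₂ (fun x y => x && !y) strict).bind fun r =>
  (clearAll allNames).bind fun _ => .ret r

/-- Decide destructive control by deleting votes. -/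
def solveDV (α : M.Γ M.k₀ ≃ Γ') (β : M.Γ M.k₁ ≃ Γ') (strict : Bool) : Prog M Bool :=
  header.bind fun _ => (pop .inp).bind fun _ => (convert α β .votes₁ true).bind fun _ =>
  (controlLoop .votes₁ (fun x y => y && !x) strict).bind fun r =>
  (clearAll allNames).bind fun _ => .ret r

/-! ### Size bounds and running time -/

theorem encList_eq {α : Type} (enc : α → List Γ') (l : List α) (r : List Γ') :
    encList enc l ++ r = Γ'.bra :: ((l.flatMap fun x => enc x ++ [Γ'.comma]) ++ Γ'.ket :: r) := by
  simp [encList]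

theorem length_encList {α : Type} (enc : α → List Γ') (l : List α) :
    (encList enc l).length = (l.map fun x => (enc x).length + 1).sum + 2 := by
  simp only [encList, List.length_append, List.length_cons, List.length_flatMap, List.length_nil]

theorem length_le_length_encList_of_mem {α : Type} (enc : α → List Γ') {l : List α} {x : α}
    (h : x ∈ l) : (enc x).length ≤ (encList enc l).length := by
  rw [length_encList]
  have : (enc x).length + 1 ≤ (l.map fun x => (enc x).length + 1).sum :=
    List.le_sum_of_mem (List.mem_map.2 ⟨x, h, rfl⟩)
  omega

theorem length_le_length_encList {α : Type} (enc : α → List Γ') (l : List α) :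
    l.length ≤ (encList enc l).length := by
  rw [length_encList]
  induction l with
  | nil => simp
  | cons x l ih =>
    simp only [List.length_cons, List.map_cons, List.sum_cons]
    omega

theorem length_selections_le (ts : TournamentSolution) (votes : List Tournament) :
    (selections ts votes).length ≤ (encList encTournament votes).length := by
  rw [length_encList]
  induction votes with
  | nil => simp [selections]
  | cons T votes ih =>
    rw [selections_cons, List.length_append, List.map_cons, List.sum_cons]
    have := length_encCandidates_sel_le ts T
    omega

theorem polynomial_eval_mono (P : Polynomial ℕ) {m n : ℕ} (h : m ≤ n) : P.eval m ≤ P.eval n := by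
  rw [Polynomial.eval_eq_sum, Polynomial.eval_eq_sum]
  exact Finset.sum_le_sum fun i _ => Nat.mul_le_mul_left _ (Nat.pow_le_pow_left h i)

/-- The running time of the decision programs. -/
noncomputable def runningTime (time : Polynomial ℕ) : Polynomial ℕ :=
  500 * (Polynomial.X + 1) ^ 3 + 2 * (Polynomial.X * time)

theorem eval_runningTime (time : Polynomial ℕ) (n : ℕ) :
    (runningTime time).eval n = 500 * (n + 1) ^ 3 + 2 * (n * time.eval n) := by
  simp [runningTime]

theorem runs_solveAV {ts : TournamentSolution} {α : M.Γ M.k₀ ≃ Γ'} {β : M.Γ M.k₁ ≃ Γ'}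
    {time : Polynomial ℕ}
    (hsub : ∀ T n, (encTournament T).length ≤ n →
      Nonempty (TM2OutputsInTime M ((encTournament T).map α.symm)
      (some ((encCandidates (ts.sel T)).map β.symm)) (time.eval n))) (strict : Bool)
    (I : AVInstance) :
    Runs (solveAV α β strict) { inp := encAV I }
      (answer (fun x y => x && !y) strict (I.registered.reverse.map ts.sel)
        (I.unregistered.reverse.map ts.sel) (min I.k I.unregistered.length) I.p
        (I.candidates.sort (· ≤ ·))) {} ((runningTime time).eval (encAV I).length) := by
  set n := (encAV I).length with hn
  set E₁ := encList encTournament I.registered with hE₁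
  set E₂ := encList encTournament I.unregistered with hE₂
  set H := encHead I.p I.k I.candidates with hH
  set cs := I.candidates.sort (· ≤ ·) with hcs
  have henc : encAV I = H ++ (E₁ ++ (E₂ ++ [])) := by
    simp [encAV, hH, hE₁, hE₂, encHead]
  have hlen : n = H.length + E₁.length + E₂.length := by
    rw [hn, henc]
    simp only [List.length_append, List.length_nil]
    omega
  have hHlen := length_encHead I.p I.k I.candidates
  rw [← hH, ← hcs] at hHlen
  rw [henc]
  have h1 := runs_header (M := M) I.p I.k I.candidates (E₁ ++ (E₂ ++ []))
  rw [← hH, ← hcs] at h1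
  rw [hE₁, encList_eq, hE₂, encList_eq] at h1 ⊢
  rw [hE₁, hE₂] at hlen
  set L₂ : List Γ' := (I.unregistered.flatMap fun x => encTournament x ++ [Γ'.comma]) ++ [Γ'.ket]
    with hL₂
  set L₁ : List Γ' := (I.registered.flatMap fun x => encTournament x ++ [Γ'.comma])
    ++ Γ'.ket :: Γ'.bra :: L₂ with hL₁
  have h2 : Runs (M := M) (pop .inp)
      { inp := Γ'.bra :: L₁, fav := revWord I.p, num := encNat I.k, cands := entries cs }
      (some .bra) { inp := L₁, fav := revWord I.p, num := encNat I.k, cands := entries cs } 2 :=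
    runs_pop_cons (a := .inp) rfl
  have hek : (encodeNat I.k).length = (encNat I.k).length := by simp [encNat]
  obtain ⟨w, hw, hwe, h3⟩ := runs_convert (M := M) (ts := ts) (α := α) (β := β) (N := n)
    (τ := time.eval n) (a := .votes₁) (.inl rfl) false (votes := I.registered)
    (fun T hT => hsub T n ((length_le_length_encList_of_mem _ hT).trans (by omega)))
    (fun T hT => (length_le_length_encList_of_mem _ hT).trans (by omega)) (w := encodeNat I.k)
    (by omega) (r := Γ'.bra :: L₂)
    (S := { inp := L₁, fav := revWord I.p, num := encNat I.k, cands := entries cs })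
    rfl rfl rfl rfl
  -- The pass over the registered votes does not touch the counter, which still holds `k` for the
  -- unregistered ones.
  obtain rfl := hwe rfl
  have e3 : ({ inp := L₁, fav := revWord I.p, num := encNat I.k, cands := entries cs } :
        St).converted ts .votes₁ I.registered (Γ'.bra :: L₂) (encodeNat I.k)
        (quotaMarks false (bitsVal (encodeNat I.k)) I.registered.length)
      = { inp := Γ'.bra :: L₂, fav := revWord I.p, num := encNat I.k, cands := entries cs,
          votes₁ := selections ts I.registered } := by
    simp [St.converted, St.set, St.get, quotaMarks, marks, encNat]
  rw [e3] at h3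
  have h4 : Runs (M := M) (pop .inp)
      { inp := Γ'.bra :: L₂, fav := revWord I.p, num := encNat I.k, cands := entries cs,
        votes₁ := selections ts I.registered }
      (some .bra) { inp := L₂, fav := revWord I.p, num := encNat I.k, cands := entries cs,
                    votes₁ := selections ts I.registered } 2 :=
    runs_pop_cons (a := .inp) rfl
  obtain ⟨w', hw', -, h5⟩ := runs_convert (M := M) (ts := ts) (α := α) (β := β) (N := n)
    (τ := time.eval n) (a := .votes₂) (.inr rfl) true (votes := I.unregistered)
    (fun T hT => hsub T n ((length_le_length_encList_of_mem _ hT).trans (by omega)))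
    (fun T hT => (length_le_length_encList_of_mem _ hT).trans (by omega)) (w := encodeNat I.k)
    (by omega) (r := [])
    (S := { inp := L₂, fav := revWord I.p, num := encNat I.k, cands := entries cs,
            votes₁ := selections ts I.registered })
    rfl rfl rfl rfl
  set q := min I.k I.unregistered.length with hq
  have e5 : ({ inp := L₂, fav := revWord I.p, num := encNat I.k, cands := entries cs,
               votes₁ := selections ts I.registered } : St).converted ts .votes₂ I.unregistered []
        w' (quotaMarks true (bitsVal (encodeNat I.k)) I.unregistered.length)
      = { fav := revWord I.p, num := w'.map Γ'.bit, cands := entries cs,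
          votes₁ := selections ts I.registered, votes₂ := selections ts I.unregistered,
          quota := marks q } := by
    simp [St.converted, St.set, St.get, quotaMarks, bitsVal_encodeNat, hq]
  rw [e5] at h5
  have hs₁ := length_selections_le ts I.registered
  have hs₂ := length_selections_le ts I.unregistered
  have hl₁ := length_le_length_encList encTournament I.registered
  have hl₂ := length_le_length_encList encTournament I.unregistered
  have hcs_len : cs.length ≤ n := by
    have h0 : cs.length ≤ (entries cs).length := by
      rw [length_entries]
      have := List.length_le_sum_of_one_le (cs.map fun n => (encNat n).length + 1) (by simp)
      rwa [List.length_map] at this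
    omega
  obtain ⟨cs', hcs', h6⟩ := runs_controlLoop (M := M) (a := .votes₂) (.inr rfl)
    (test := fun x y => x && !y) strict (vs := I.registered.reverse.map ts.sel)
    (vs' := I.unregistered.reverse.map ts.sel) (cs := cs) (p := I.p) (q := q) (N := n)
    (S := { fav := revWord I.p, num := w'.map Γ'.bit, cands := entries cs,
            votes₁ := selections ts I.registered, votes₂ := selections ts I.unregistered,
            quota := marks q })
    rfl rfl rfl rfl rfl rfl rfl rfl rfl rfl rfl rfl rfl (hs₁.trans (by omega))
    (hs₂.trans (by omega)) (by omega) (by omega)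
  have h7 := runs_clearAll_allNames (M := M) (N := n)
    (S := { fav := revWord I.p, num := w'.map Γ'.bit, cands := entries cs',
            votes₁ := selections ts I.registered, votes₂ := selections ts I.unregistered,
            quota := marks q }) (by
      have hq' : q ≤ n := (min_le_right _ _).trans (hl₂.trans (by omega))
      have hp' : (revWord I.p).length ≤ n := by
        rw [revWord, List.length_reverse]
        omega
      intro a
      cases a <;> simp only [St.get, List.length_nil, List.length_map, length_marks] <;> omega)
  set ans := answer (fun x y => x && !y) strict (I.registered.reverse.map ts.sel)
        (I.unregistered.reverse.map ts.sel) q I.p cs with hans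
  have h8 : Runs (M := M) ((clearAll allNames).bind fun _ => .ret ans)
      { fav := revWord I.p, num := w'.map Γ'.bit, cands := entries cs',
        votes₁ := selections ts I.registered, votes₂ := selections ts I.unregistered,
        quota := marks q } ans {} (15 * (3 * n + 3)) := h7.bind (m := 0) (runs_ret _ _)
  refine (h1.bind (h2.bind (h3.bind (h4.bind (h5.bind (h6.bind h8)))))).mono ?_
  rw [eval_runningTime]
  -- The lists have at most `n` votes, so the subroutine calls cost at most `2 * (n * time.eval n)`.
  -- The cubic term covers at most `n` opponents at `400 * (n + 1) ^ 2` each, and the lower-order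
  -- rest.
  have b1 : I.registered.length * (28 * n + time.eval n + 40)
      ≤ n * (28 * n + time.eval n + 40) := Nat.mul_le_mul_right _ (hl₁.trans (by omega))
  have b2 : I.unregistered.length * (28 * n + time.eval n + 40)
      ≤ n * (28 * n + time.eval n + 40) := Nat.mul_le_mul_right _ (hl₂.trans (by omega))
  have b3 : cs.length * (400 * (n + 1) ^ 2) ≤ n * (400 * (n + 1) ^ 2) :=
    Nat.mul_le_mul_right _ hcs_len
  have b4 : H.length ≤ n := by omega
  nlinarith

/-- Here one list plays both roles: it gives the scores and supplies the votes that can be deleted.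
Accordingly the test asks for `p` selected and the opponent not. -/
theorem runs_solveDV {ts : TournamentSolution} {α : M.Γ M.k₀ ≃ Γ'} {β : M.Γ M.k₁ ≃ Γ'}
    {time : Polynomial ℕ}
    (hsub : ∀ T n, (encTournament T).length ≤ n →
      Nonempty (TM2OutputsInTime M ((encTournament T).map α.symm)
      (some ((encCandidates (ts.sel T)).map β.symm)) (time.eval n))) (strict : Bool)
    (I : DVInstance) :
    Runs (solveDV α β strict) { inp := encDV I }
      (answer (fun x y => y && !x) strict (I.votes.reverse.map ts.sel)
        (I.votes.reverse.map ts.sel) (min I.k I.votes.length) I.p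
        (I.candidates.sort (· ≤ ·))) {} ((runningTime time).eval (encDV I).length) := by
  set n := (encDV I).length with hn
  set E := encList encTournament I.votes with hE
  set H := encHead I.p I.k I.candidates with hH
  set cs := I.candidates.sort (· ≤ ·) with hcs
  have henc : encDV I = H ++ (E ++ []) := by
    simp [encDV, hH, hE, encHead]
  have hlen : n = H.length + E.length := by
    rw [hn, henc]
    simp only [List.length_append, List.length_nil]
    omega
  have hHlen := length_encHead I.p I.k I.candidates
  rw [← hH, ← hcs] at hHlen
  rw [henc]
  have h1 := runs_header (M := M) I.p I.k I.candidates (E ++ [])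
  rw [← hH, ← hcs] at h1
  rw [hE, encList_eq] at h1 ⊢
  rw [hE] at hlen
  set L : List Γ' := (I.votes.flatMap fun x => encTournament x ++ [Γ'.comma]) ++ [Γ'.ket]
    with hL
  have h2 : Runs (M := M) (pop .inp)
      { inp := Γ'.bra :: L, fav := revWord I.p, num := encNat I.k, cands := entries cs }
      (some .bra) { inp := L, fav := revWord I.p, num := encNat I.k, cands := entries cs } 2 :=
    runs_pop_cons (a := .inp) rfl
  have hek : (encodeNat I.k).length = (encNat I.k).length := by simp [encNat]
  obtain ⟨w', hw', -, h5⟩ := runs_convert (M := M) (ts := ts) (α := α) (β := β) (N := n)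
    (τ := time.eval n) (a := .votes₁) (.inl rfl) true (votes := I.votes)
    (fun T hT => hsub T n ((length_le_length_encList_of_mem _ hT).trans (by omega)))
    (fun T hT => (length_le_length_encList_of_mem _ hT).trans (by omega)) (w := encodeNat I.k)
    (by omega) (r := [])
    (S := { inp := L, fav := revWord I.p, num := encNat I.k, cands := entries cs })
    rfl rfl rfl rfl
  set q := min I.k I.votes.length with hq
  have e5 : ({ inp := L, fav := revWord I.p, num := encNat I.k, cands := entries cs } :
        St).converted ts .votes₁ I.votes []
        w' (quotaMarks true (bitsVal (encodeNat I.k)) I.votes.length)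
      = { fav := revWord I.p, num := w'.map Γ'.bit, cands := entries cs,
          votes₁ := selections ts I.votes, quota := marks q } := by
    simp [St.converted, St.set, St.get, quotaMarks, bitsVal_encodeNat, hq]
  rw [e5] at h5
  have hs := length_selections_le ts I.votes
  have hl := length_le_length_encList encTournament I.votes
  have hcs_len : cs.length ≤ n := by
    have h0 : cs.length ≤ (entries cs).length := by
      rw [length_entries]
      have := List.length_le_sum_of_one_le (cs.map fun n => (encNat n).length + 1) (by simp)
      rwa [List.length_map] at this
    omega
  obtain ⟨cs', hcs', h6⟩ := runs_controlLoop (M := M) (a := .votes₁) (.inl rfl)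
    (test := fun x y => y && !x) strict (vs := I.votes.reverse.map ts.sel)
    (vs' := I.votes.reverse.map ts.sel) (cs := cs) (p := I.p) (q := q) (N := n)
    (S := { fav := revWord I.p, num := w'.map Γ'.bit, cands := entries cs,
            votes₁ := selections ts I.votes, quota := marks q })
    rfl rfl rfl rfl rfl rfl rfl rfl rfl rfl rfl rfl rfl (hs.trans (by omega))
    (hs.trans (by omega)) (by omega) (by omega)
  have h7 := runs_clearAll_allNames (M := M) (N := n)
    (S := { fav := revWord I.p, num := w'.map Γ'.bit, cands := entries cs',
            votes₁ := selections ts I.votes, quota := marks q }) (by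
      have hq' : q ≤ n := (min_le_right _ _).trans (hl.trans (by omega))
      have hp' : (revWord I.p).length ≤ n := by
        rw [revWord, List.length_reverse]
        omega
      intro a
      cases a <;> simp only [St.get, List.length_nil, List.length_map, length_marks] <;> omega)
  set ans := answer (fun x y => y && !x) strict (I.votes.reverse.map ts.sel)
        (I.votes.reverse.map ts.sel) q I.p cs with hans
  have h8 : Runs (M := M) ((clearAll allNames).bind fun _ => .ret ans)
      { fav := revWord I.p, num := w'.map Γ'.bit, cands := entries cs',
        votes₁ := selections ts I.votes, quota := marks q } ans {} (15 * (3 * n + 3)) :=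
    h7.bind (m := 0) (runs_ret _ _)
  refine (h1.bind (h2.bind (h5.bind (h6.bind h8)))).mono ?_
  rw [eval_runningTime]
  have b1 : I.votes.length * (28 * n + time.eval n + 40)
      ≤ n * (28 * n + time.eval n + 40) := Nat.mul_le_mul_right _ (hl.trans (by omega))
  have b3 : cs.length * (400 * (n + 1) ^ 2) ≤ n * (400 * (n + 1) ^ 2) :=
    Nat.mul_le_mul_right _ hcs_len
  have b4 : H.length ≤ n := by omega
  nlinarith

end Routines

/-! ### Characterization of the yes-instances -/

/-- Whether an opponent has to overtake the distinguished candidate (rather than draw level). -/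
def WinnerModel.strict : WinnerModel → Bool
  | .unique => false
  | .nonunique => true

/-- In the unique-winner model a rival on level terms suffices: if `p` attains the maximum, so does
the rival. In the nonunique-winner model somebody must be strictly ahead, and this cannot be `p`.
The summand `1` turns `<` into `≤`, so that both models share one inequality. -/
theorem not_wins_iff (ts : TournamentSolution) {C : Finset ℕ} {p : ℕ} (hp : p ∈ C)
    (votes : List Tournament) (model : WinnerModel) :
    ¬ Wins ts C p votes model ↔ ∃ d ∈ C, d ≠ p ∧
      score ts votes p < score ts votes d + if model.strict then 0 else 1 := by
  cases model with
  | unique =>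
    simp only [Wins, WinnerModel.strict, Bool.false_eq_true, if_false, Nat.lt_succ_iff]
    constructor
    · intro h
      by_contra! hcon
      refine h (Finset.ext fun c => ?_)
      simp only [winners, Finset.mem_filter, Finset.mem_singleton]
      constructor
      · rintro ⟨hc, hmax⟩
        by_contra hcp
        exact absurd (hmax p hp) (by have := hcon c hc hcp; omega)
      · rintro rfl
        refine ⟨hp, fun d hd => ?_⟩
        by_cases hdp : d = c
        · rw [hdp]
        · have := hcon d hd hdp
          omega
    · rintro ⟨d, hd, hdp, hle⟩ h
      have hpw : p ∈ winners ts C votes := h ▸ Finset.mem_singleton_self p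
      have hdw : d ∈ winners ts C votes := by
        simp only [winners, Finset.mem_filter] at hpw ⊢
        exact ⟨hd, fun e he => (hpw.2 e he).trans hle⟩
      rw [h] at hdw
      exact hdp (Finset.mem_singleton.1 hdw)
  | nonunique =>
    simp only [Wins, WinnerModel.strict, if_true, winners, Finset.mem_filter, hp, true_and,
      Nat.add_zero]
    push Not
    exact ⟨fun ⟨d, hd, h⟩ => ⟨d, hd, by rintro rfl; exact lt_irrefl _ h, h⟩,
      fun ⟨d, hd, _, h⟩ => ⟨d, hd, h⟩⟩

/-! ### The largest gain from at most `k` votes -/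

section Counting

variable {α : Type}

theorem countP_le_countP_add_countP_and_not (P Q : α → Bool) (l : List α) :
    l.countP P ≤ l.countP Q + l.countP fun x => P x && !Q x := by
  induction l with
  | nil => simp
  | cons x l ih =>
    simp only [List.countP_cons]
    cases P x <;> cases Q x <;> simp <;> omega

/-- The complement of a sublist. It passes from the remaining votes to the deleted ones, and back.
-/
theorem exists_sublist_perm_append {l' l : List α} (h : l'.Sublist l) :
    ∃ r : List α, r.Sublist l ∧ l.Perm (l' ++ r) := by
  induction h with
  | slnil => exact ⟨[], .refl _, .refl _⟩
  | @cons l₁ l₂ a _ ih =>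
    obtain ⟨r, hr, hp⟩ := ih
    exact ⟨a :: r, hr.cons_cons a, (hp.cons a).trans List.perm_middle.symm⟩
  | @cons_cons l₁ l₂ a _ ih =>
    obtain ⟨r, hr, hp⟩ := ih
    exact ⟨r, hr.cons a, hp.cons a⟩

theorem exists_sublist_countP (P : α → Bool) (l : List α) (k : ℕ) :
    ∃ l' : List α, l'.Sublist l ∧ l'.length = min (l.countP P) k ∧ ∀ x ∈ l', P x = true := by
  refine ⟨(l.filter P).take k, (List.take_sublist _ _).trans List.filter_sublist, ?_,
    fun x hx => List.of_mem_filter (List.mem_of_mem_take hx)⟩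
  rw [List.length_take, List.countP_eq_length_filter, min_comm]

/-- With `P` for the opponent and `Q` for `p`, an added vote raises the difference only if it
satisfies `P` and not `Q`, and then by one. This bounds the gain by the number of such votes and by
`k`. -/
theorem countP_append_gain (P Q : α → Bool) (l₁ l₂ : List α) (k b : ℕ) :
    (∃ l : List α, l.Sublist l₂ ∧ l.length ≤ k ∧ (l₁ ++ l).countP Q < (l₁ ++ l).countP P + b) ↔
      l₁.countP Q < min (l₂.countP fun x => P x && !Q x) k + l₁.countP P + b := by
  constructor
  · rintro ⟨l, hl, hk, h⟩
    rw [List.countP_append, List.countP_append] at h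
    have h1 := countP_le_countP_add_countP_and_not P Q l
    have h2 : l.countP (fun x => P x && !Q x) ≤ l₂.countP fun x => P x && !Q x := hl.countP_le
    have h3 : l.countP (fun x => P x && !Q x) ≤ l.length := List.countP_le_length
    omega
  · intro h
    -- The greedy choice: only helpful votes, as many as exist and are allowed.
    obtain ⟨l, hl, hlen, hP⟩ := exists_sublist_countP (fun x => P x && !Q x) l₂ k
    refine ⟨l, hl, hlen ▸ min_le_right _ _, ?_⟩
    have h1 : l.countP P = l.length := List.countP_eq_length.2 fun x hx => by
      have := hP x hx
      simp_all
    have h2 : l.countP Q = 0 := List.countP_eq_zero.2 fun x hx => by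
      have := hP x hx
      simp_all
    rw [List.countP_append, List.countP_append, h1, h2, hlen]
    omega

/-- The same argument for the deleted votes `r`: counts over the whole list are sums over the
remaining part and `r`, and `r` helps only through its votes with `Q` and not `P`. -/
theorem countP_remaining_gain (P Q : α → Bool) (l₁ : List α) (k b : ℕ) :
    (∃ l : List α, l.Sublist l₁ ∧ l₁.length ≤ l.length + k ∧ l.countP Q < l.countP P + b) ↔
      l₁.countP Q < min (l₁.countP fun x => Q x && !P x) k + l₁.countP P + b := by
  constructor
  · rintro ⟨l, hl, hk, h⟩
    obtain ⟨r, hr, hp⟩ := exists_sublist_perm_append hl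
    have hlen := hp.length_eq
    have hcP := hp.countP_eq P
    have hcQ := hp.countP_eq Q
    rw [List.countP_append] at hcP hcQ
    rw [List.length_append] at hlen
    have h1 := countP_le_countP_add_countP_and_not Q P r
    have h2 : r.countP (fun x => Q x && !P x) ≤ l₁.countP fun x => Q x && !P x := hr.countP_le
    have h3 : r.countP (fun x => Q x && !P x) ≤ r.length := List.countP_le_length
    omega
  · intro h
    obtain ⟨r, hr, hrlen, hP⟩ := exists_sublist_countP (fun x => Q x && !P x) l₁ k
    obtain ⟨l, hl, hp⟩ := exists_sublist_perm_append hr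
    have hlen := hp.length_eq
    have hcP := hp.countP_eq P
    have hcQ := hp.countP_eq Q
    rw [List.countP_append] at hcP hcQ
    rw [List.length_append] at hlen
    have h1 : r.countP Q = r.length := List.countP_eq_length.2 fun x hx => by
      have := hP x hx
      simp_all
    have h2 : r.countP P = 0 := List.countP_eq_zero.2 fun x hx => by
      have := hP x hx
      simp_all
    exact ⟨l, hl, by omega, by omega⟩

end Counting

/-- Capping `k` at the length of the list is harmless, since the helpful votes are no more numerous
than the list. Reversing the votes leaves all counts unchanged. -/
theorem answer_iff (test : Bool → Bool → Bool) (strict : Bool) (ts : TournamentSolution)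
    (l₁ l₂ : List Tournament) (k p : ℕ) (C : Finset ℕ) :
    answer test strict (l₁.reverse.map ts.sel) (l₂.reverse.map ts.sel) (min k l₂.length) p
        (C.sort (· ≤ ·)) = true ↔
      ∃ d ∈ C, d ≠ p ∧ score ts l₁ p < min (l₂.countP fun T =>
        test (decide (d ∈ ts.sel T)) (decide (p ∈ ts.sel T))) k + score ts l₁ d +
          if strict then 0 else 1 := by
  simp only [answer, outcome, List.any_eq_true, Finset.mem_sort, Bool.and_eq_true,
    Bool.not_eq_true', decide_eq_false_iff_not, decide_eq_true_eq, List.countP_map,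
    List.countP_reverse, score, Function.comp_def]
  refine exists_congr fun d => and_congr_right fun _ => and_congr_right fun _ => ?_
  have h : l₂.countP (fun T => test (decide (d ∈ ts.sel T)) (decide (p ∈ ts.sel T)))
      ≤ l₂.length := List.countP_le_length
  rw [show min (l₂.countP fun T => test (decide (d ∈ ts.sel T)) (decide (p ∈ ts.sel T)))
      (min k l₂.length) = min (l₂.countP fun T =>
        test (decide (d ∈ ts.sel T)) (decide (p ∈ ts.sel T))) k by omega]

theorem dcav_iff (ts : TournamentSolution) (model : WinnerModel) (I : AVInstance) :
    answer (fun x y => x && !y) model.strict (I.registered.reverse.map ts.sel)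
      (I.unregistered.reverse.map ts.sel) (min I.k I.unregistered.length) I.p
      (I.candidates.sort (· ≤ ·)) = true ↔ DCAV ts model I := by
  rw [answer_iff]
  simp only [DCAV, not_wins_iff ts I.p_mem]
  constructor
  · rintro ⟨d, hd, hdp, h⟩
    obtain ⟨l, hl, hk, h'⟩ := (countP_append_gain (fun T => decide (d ∈ ts.sel T))
      (fun T => decide (I.p ∈ ts.sel T)) I.registered I.unregistered I.k _).2 h
    exact ⟨l, hl, hk, d, hd, hdp, h'⟩
  · rintro ⟨l, hl, hk, d, hd, hdp, h'⟩
    exact ⟨d, hd, hdp, (countP_append_gain (fun T => decide (d ∈ ts.sel T))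
      (fun T => decide (I.p ∈ ts.sel T)) I.registered I.unregistered I.k _).1 ⟨l, hl, hk, h'⟩⟩

theorem dcdv_iff (ts : TournamentSolution) (model : WinnerModel) (I : DVInstance) :
    answer (fun x y => y && !x) model.strict (I.votes.reverse.map ts.sel)
      (I.votes.reverse.map ts.sel) (min I.k I.votes.length) I.p
      (I.candidates.sort (· ≤ ·)) = true ↔ DCDV ts model I := by
  rw [answer_iff]
  simp only [DCDV, not_wins_iff ts I.p_mem]
  constructor
  · rintro ⟨d, hd, hdp, h⟩
    obtain ⟨l, hl, hk, h'⟩ := (countP_remaining_gain (fun T => decide (d ∈ ts.sel T))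
      (fun T => decide (I.p ∈ ts.sel T)) I.votes I.k _).2 h
    exact ⟨l, hl, hk, d, hd, hdp, h'⟩
  · rintro ⟨l, hl, hk, d, hd, hdp, h'⟩
    exact ⟨d, hd, hdp, (countP_remaining_gain (fun T => decide (d ∈ ts.sel T))
      (fun T => decide (I.p ∈ ts.sel T)) I.votes I.k _).1 ⟨l, hl, hk, h'⟩⟩

end TSApproval

open TSApproval in
theorem mainTheorem10 (ts : TSApproval.TournamentSolution) (hts : ts.PolyTimeComputable)
    (model : TSApproval.WinnerModel) :
    TSApproval.PolyTimeSolvable TSApproval.encAV (TSApproval.DCAV ts model) ∧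
      TSApproval.PolyTimeSolvable TSApproval.encDV (TSApproval.DCDV ts model) := by
  obtain ⟨sub⟩ := hts
  -- A polynomial with natural coefficients is monotone, so one time bound, taken at the length of
  -- the whole instance, serves all calls.
  have hsub : ∀ T n, (encTournament T).length ≤ n →
      Nonempty (Turing.TM2OutputsInTime sub.tm ((encTournament T).map sub.inputAlphabet.symm)
        (some ((encCandidates (ts.sel T)).map sub.outputAlphabet.symm)) (sub.time.eval n)) :=
    fun T n h => ⟨{ sub.outputsFun T with
      steps_le_m := (sub.outputsFun T).steps_le_m.trans (polynomial_eval_mono _ h) }⟩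
  exact ⟨polyTimeSolvable_of_runs (solveAV sub.inputAlphabet sub.outputAlphabet model.strict)
      (runningTime sub.time) fun I => ⟨_, dcav_iff ts model I, runs_solveAV hsub model.strict I⟩,
    polyTimeSolvable_of_runs (solveDV sub.inputAlphabet sub.outputAlphabet model.strict)
      (runningTime sub.time) fun I => ⟨_, dcdv_iff ts model I, runs_solveDV hsub model.strict I⟩⟩
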